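/- Let $\alpha_0>0$ and let $f:\mathbb{R}\to\mathbb{R}$ satisfy $f(s)=0$ for all $s\le 0$ together with $(f_1)$ $f$ is continuous and nonnegative on $[0,\infty)$ and $\displaystyle\lim_{s\to0^+}\frac{f(s)}{s^3}=0$; $(f_2)$ $\displaystyle\lim_{s\to+\infty}\frac{f(s)}{e^{\alpha s^2}}=0$ for every $\alpha>\alpha_0$, and $\displaystyle\lim_{s\to+\infty}\frac{f(s)}{e^{\alpha s^2}}=+\infty$ for every $\alpha<\alpha_0$. Put $F(s)=\int_0^s f(t)\,dt$. Let $u_n\rightharpoonup u_0$ weakly in $H^1(\mathbb{R}^2)$ with $$\limsup_{n\to\infty}\|\nabla(u_n-u_0)\|_{L^2(\mathbb{R}^2)}^2<\frac{4\pi}{\alpha_0}.$$ Then all the integrals below converge absolutely and, as $n\to\infty$, $$\int_{\mathbb{R}^2}F(u_n)\,dx=\int_{\mathbb{R}^2}F(u_0)\,dx+\int_{\mathbb{R}^2}F(u_n-u_0)\,dx+o(1).$$ Suppose further that $f\in C^1(\mathbb{R})$ and that there are $\alpha>\alpha_0$ and $q>4$ such that for every $\varepsilon>0$ there is $C_\varepsilon>0$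 with $$|f'(s)|\le\varepsilon|s|^2+C_\varepsilon|s|^{q-2}\left(e^{\alpha|s|^2}-1\right)\qquad\text{for all } s\in\mathbb{R}.$$ Then also all the integrals below converge absolutely and, as $n\to\infty$, $$\int_{\mathbb{R}^2}f(u_n)u_n\,dx=\int_{\mathbb{R}^2}f(u_0)u_0\,dx+\int_{\mathbb{R}^2}f(u_n-u_0)(u_n-u_0)\,dx+o(1).$$ -/

import Mathlib

open MeasureTheory Filter Topology
open scoped ContDiff

/-- The space `ℝ^N` with its Euclidean norm and Lebesgue measure. -/
abbrev RSpace (N : ℕ) : Type := EuclideanSpace ℝ (Fin N)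

/-- `g` is a weak gradient of `u` on `ℝ^N`: integration by parts holds in every direction `v`
against every smooth compactly supported test function. -/
def IsWeakGradient {N : ℕ} (u : RSpace N → ℝ) (g : RSpace N → RSpace N) : Prop :=
  ∀ φ : RSpace N → ℝ, ContDiff ℝ ∞ φ → HasCompactSupport φ → ∀ v : RSpace N,
    ∫ x, u x * fderiv ℝ φ x v = - ∫ x, inner ℝ (g x) v * φ x

theorem memLp_two_of_test {N : ℕ} {ψ : RSpace N → ℝ} (hc : Continuous ψ)
    (hs : HasCompactSupport ψ) : MemLp ψ 2 (volume : Measure (RSpace N)) :=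
  hc.memLp_of_hasCompactSupport hs

theorem integrable_mul_fderiv_test {N : ℕ} (u : Lp ℝ 2 (volume : Measure (RSpace N)))
    {φ : RSpace N → ℝ} (hφ : ContDiff ℝ ∞ φ) (hs : HasCompactSupport φ) (v : RSpace N) :
    Integrable (fun x => u x * fderiv ℝ φ x v) := by
  have hc : Continuous (fun x => fderiv ℝ φ x v) :=
    (hφ.continuous_fderiv (by simp)).clm_apply continuous_const
  exact (Lp.memLp u).integrable_mul (memLp_two_of_test hc (hs.fderiv_apply ℝ v))

theorem integrable_inner_mul_test {N : ℕ} (g : Lp (RSpace N) 2 (volume : Measure (RSpace N)))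
    {φ : RSpace N → ℝ} (hφ : ContDiff ℝ ∞ φ) (hs : HasCompactSupport φ) (v : RSpace N) :
    Integrable (fun x => inner ℝ (g x) v * φ x) := by
  have hg : MemLp (fun x => inner ℝ (g x) v) 2 (volume : Measure (RSpace N)) :=
    (Lp.memLp g).inner_const v
  exact hg.integrable_mul (memLp_two_of_test hφ.continuous hs)

/-- The Sobolev space `H^1(ℝ^N)`: pairs `(u, ∇u)` in `L² × L²` in which the second entry is the
weak gradient of the first (it is determined by the first almost everywhere). The ambient `ℓ²`-sum
gives it the norm `(‖∇u‖₂² + ‖u‖₂²)^(1/2)` and the corresponding inner product. -/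
def sobolevH1 (N : ℕ) : Submodule ℝ (WithLp 2
    (Lp ℝ 2 (volume : Measure (RSpace N)) × Lp (RSpace N) 2 (volume : Measure (RSpace N)))) where
  carrier := {w | IsWeakGradient (fun x => w.fst x) (fun x => w.snd x)}
  zero_mem' := by
    intro φ hφ hs v
    have h1 : ∫ x, (0 : Lp ℝ 2 (volume : Measure (RSpace N))) x * fderiv ℝ φ x v = 0 := by
      refine integral_eq_zero_of_ae ?_
      filter_upwards [Lp.coeFn_zero ℝ 2 (volume : Measure (RSpace N))] with x hx
      rw [hx]; simp
    have h2 : ∫ x, inner ℝ ((0 : Lp (RSpace N) 2 (volume : Measure (RSpace N))) x) v * φ x = 0 := by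
      refine integral_eq_zero_of_ae ?_
      filter_upwards [Lp.coeFn_zero (RSpace N) 2 (volume : Measure (RSpace N))] with x hx
      rw [hx]; simp
    simp only [WithLp.zero_fst, WithLp.zero_snd]
    rw [h1, h2, neg_zero]
  add_mem' := by
    intro a b ha hb φ hφ hs v
    have h1 : ∫ x, (a.fst + b.fst) x * fderiv ℝ φ x v
        = (∫ x, a.fst x * fderiv ℝ φ x v) + ∫ x, b.fst x * fderiv ℝ φ x v := by
      rw [← integral_add (integrable_mul_fderiv_test _ hφ hs v)
        (integrable_mul_fderiv_test _ hφ hs v)]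
      refine integral_congr_ae ?_
      filter_upwards [Lp.coeFn_add a.fst b.fst] with x hx
      rw [hx, Pi.add_apply, add_mul]
    have h2 : ∫ x, inner ℝ ((a.snd + b.snd) x) v * φ x
        = (∫ x, inner ℝ (a.snd x) v * φ x) + ∫ x, inner ℝ (b.snd x) v * φ x := by
      rw [← integral_add (integrable_inner_mul_test _ hφ hs v)
        (integrable_inner_mul_test _ hφ hs v)]
      refine integral_congr_ae ?_
      filter_upwards [Lp.coeFn_add a.snd b.snd] with x hx
      rw [hx, Pi.add_apply, inner_add_left, add_mul]
    simp only [WithLp.add_fst, WithLp.add_snd]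
    rw [h1, h2, ha φ hφ hs v, hb φ hφ hs v, neg_add]
  smul_mem' := by
    intro c a ha φ hφ hs v
    have h1 : ∫ x, (c • a.fst) x * fderiv ℝ φ x v = c * ∫ x, a.fst x * fderiv ℝ φ x v := by
      rw [← integral_const_mul]
      refine integral_congr_ae ?_
      filter_upwards [Lp.coeFn_smul c a.fst] with x hx
      simp [hx, mul_assoc]
    have h2 : ∫ x, inner ℝ ((c • a.snd) x) v * φ x = c * ∫ x, inner ℝ (a.snd x) v * φ x := by
      rw [← integral_const_mul]
      refine integral_congr_ae ?_
      filter_upwards [Lp.coeFn_smul c a.snd] with x hx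
      simp [hx, inner_smul_left, mul_assoc]
    simp only [WithLp.smul_fst, WithLp.smul_snd]
    rw [h1, h2, ha φ hφ hs v, mul_neg]

/-- `H^1(ℝ^N)` as a type, with the norm and inner product inherited from `sobolevH1 N`. -/
abbrev H1 (N : ℕ) : Type := sobolevH1 N

/-- The underlying function `ℝ^N → ℝ` of an element of `H^1(ℝ^N)` (an a.e. representative). -/
noncomputable def H1.fn {N : ℕ} (w : H1 N) : RSpace N → ℝ := fun x => w.1.fst x

/-- The weak gradient `∇w` as an element of `L²(ℝ^N; ℝ^N)`. -/
noncomputable def H1.grad {N : ℕ} (w : H1 N) : Lp (RSpace N) 2 (volume : Measure (RSpace N)) :=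
  w.1.snd

/-- Weak convergence in a real normed space: every continuous linear functional converges. -/
def WeaklyConverges {X : Type*} [NormedAddCommGroup X] [NormedSpace ℝ X] (u : ℕ → X) (u₀ : X) :
    Prop :=
  ∀ ℓ : X →L[ℝ] ℝ, Tendsto (fun n => ℓ (u n)) atTop (𝓝 (ℓ u₀))

/-- Condition `(f₁)`: `f` is continuous and nonnegative on `[0, ∞)` and `f(u)/u³ → 0` as `u → 0+`. -/
structure CondF1 (f : ℝ → ℝ) : Prop where
  cont : ContinuousOn f (Set.Ici 0)
  nonneg : ∀ u, 0 ≤ u → 0 ≤ f u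
  small : Tendsto (fun u => f u / u ^ 3) (𝓝[>] 0) (𝓝 0)

/-- Condition `(f₂)`: exponential critical growth at `+∞` with critical exponent `α₀ > 0`. -/
structure CondF2 (f : ℝ → ℝ) (α₀ : ℝ) : Prop where
  pos : 0 < α₀
  above : ∀ α, α₀ < α → Tendsto (fun u => f u / Real.exp (α * u ^ 2)) atTop (𝓝 0)
  below : ∀ α, α < α₀ → Tendsto (fun u => f u / Real.exp (α * u ^ 2)) atTop atTop

/-- The primitive `F(u) = ∫_0^u f(s) ds`. -/
noncomputable def primitiveF (f : ℝ → ℝ) (u : ℝ) : ℝ := ∫ s in (0 : ℝ)..u, f s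

/-- The splitting `∫ G(u_n) = ∫ G(u₀) + ∫ G(u_n - u₀) + o(1)` for a sequence in `H^1(ℝ^N)`,
including the assertion that all the integrals converge absolutely. -/
def BrezisLiebSplitting {N : ℕ} (G : ℝ → ℝ) (u : ℕ → H1 N) (u₀ : H1 N) : Prop :=
  (∀ n, Integrable (fun x => G ((u n).fn x))) ∧
  Integrable (fun x => G (u₀.fn x)) ∧
  (∀ n, Integrable (fun x => G ((u n - u₀).fn x))) ∧
  Tendsto (fun n => (∫ x, G ((u n).fn x)) -
    ((∫ x, G (u₀.fn x)) + ∫ x, G ((u n - u₀).fn x))) atTop (𝓝 0)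

/-! Both nonlinearities, $F(s)$ and $f(s)s$, are continuous, $o(s^2)$ at the origin, and
$O(e^{\gamma s^2})$ for every $\gamma>\alpha_0$ (`SubExpGrowth`). The splitting is proved for every
such $G$ by the Brezis–Lieb method. With $a=u_n-u_0$ and $b=u_0$, the pointwise inequality
$|G(a+b)-G(a)|\le\varepsilon(e^{\gamma a^2}-1)+C(e^{Kb^2}-1)$ leaves a fixed integrable majorant
plus $\varepsilon$ times a quantity with bounded integral. Along a subsequence $u_n\to u_0$ a.e., so
dominated convergence applies.

Two integrability facts are needed: $e^{\gamma w^2}-1$ is integrable for each fixed $w\in H^1$ and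
every $\gamma$, and its integral is uniformly bounded when $\|w\|_2$ is bounded and $\gamma\|\nabla
w\|_2^2$ stays below $4\pi$. Both come from a frequency cutoff at radius $\rho$. By Cauchy–Schwarz
the low part has sup norm at most $\sqrt{\frac{S}{4\pi}\log(1+(2\pi\rho)^2/l)}$ with $S=\|\nabla
w\|_2^2+l\|w\|_2^2$, while the high part has squared $L^2$ norm at most $\|\nabla
w\|_2^2/(2\pi\rho)^2$. Choosing $\rho$ according to the level $t$ gives $|\{|w|>t\}|\lesssim
e^{-4\pi(t-1)^2/S}$ for large $t$, and summing over integer levels gives the integral bound. For a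
fixed $w$, charging only the energy outside a large ball makes $S$ arbitrarily small.

The same cutoff gives local compactness: the low part at a point is a continuous functional of $w$,
so it tends to zero along weakly null sequences, and the high part is uniformly small in $L^2$. -/

open scoped FourierTransform SchwartzMap LineDeriv

/-! ### The $L^2$ Fourier transform, its integral formula, and weak derivatives. -/

section FourierL2

variable {V : Type*} [NormedAddCommGroup V] [InnerProductSpace ℝ V] [FiniteDimensional ℝ V]
  [MeasurableSpace V] [BorelSpace V]

/-- Two functions that agree as distributions tested against Schwartz functions agree a.e. -/
theorem ae_eq_of_integral_schwartz_mul_eq {f g : V → ℂ} (hf : LocallyIntegrable f)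
    (hg : LocallyIntegrable g) (h : ∀ φ : 𝓢(V, ℂ), ∫ x, φ x * f x = ∫ x, φ x * g x) :
    f =ᵐ[volume] g := by
  refine ae_eq_of_integral_contDiff_smul_eq hf hg fun φ hφ hs => ?_
  have hs' : HasCompactSupport (Complex.ofRealCLM ∘ φ) := hs.comp_left rfl
  have hφ' : ContDiff ℝ ∞ (Complex.ofRealCLM ∘ φ) := by fun_prop
  simpa using h (hs'.toSchwartzMap hφ')

/-- On `L¹ ∩ L²` the Plancherel extension of the Fourier transform is given by the integral. -/
theorem Lp_fourier_ae_eq_integral (f : Lp ℂ 2 (volume : Measure V)) (hf : Integrable f) :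
    (𝓕 f : Lp ℂ 2 (volume : Measure V)) =ᵐ[volume] 𝓕 (f : V → ℂ) := by
  have hcont : Continuous (𝓕 (f : V → ℂ)) :=
    VectorFourier.fourierIntegral_continuous Real.continuous_fourierChar
      (L := innerₗ V) (by exact continuous_inner) hf
  refine ae_eq_of_integral_schwartz_mul_eq
    ((Lp.memLp _).locallyIntegrable (by norm_num)) hcont.locallyIntegrable fun φ => ?_
  have h1 : ∫ x, φ x * (𝓕 f : Lp ℂ 2 (volume : Measure V)) x = ∫ x, 𝓕 φ x * f x := by
    have h := congrArg (fun T : 𝓢'(V, ℂ) => T φ) (Lp.fourier_toTemperedDistribution_eq f)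
    simpa using h.symm
  rw [h1]
  have h2 := VectorFourier.integral_fourierIntegral_smul_eq_flip (L := innerₗ V)
    (μ := volume) (ν := volume) (f := (φ : V → ℂ)) (g := f)
    Real.continuous_fourierChar (by exact continuous_inner) φ.integrable hf
  simpa using! h2

/-- If `G` is the weak derivative of `T` in direction `m`, in the sense of tempered distributions,
then their inverse Fourier transforms differ by the factor `-2πi⟨ξ, m⟩`. -/
theorem Lp_fourierInv_ae_eq_of_lineDeriv {T G : Lp ℂ 2 (volume : Measure V)} {m : V}
    (h : ∀ φ : 𝓢(V, ℂ), ∫ x, (∂_{m} φ) x * T x = - ∫ x, φ x * G x) :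
    (𝓕⁻ G : Lp ℂ 2 (volume : Measure V)) =ᵐ[volume]
      fun ξ => -(2 * Real.pi * Complex.I) * (inner ℝ ξ m : ℝ) *
        (𝓕⁻ T : Lp ℂ 2 (volume : Measure V)) ξ := by
  have hT : ∂_{m} (T : 𝓢'(V, ℂ)) = (G : 𝓢'(V, ℂ)) := by
    ext φ
    have := h φ
    simp only [TemperedDistribution.lineDerivOp_apply_apply, map_neg,
      Lp.toTemperedDistribution_apply, smul_eq_mul, this, neg_neg]
  have hU := congrArg (fun S : 𝓢'(V, ℂ) => 𝓕⁻ S) hT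
  simp only [TemperedDistribution.fourierInv_lineDerivOp_eq,
    Lp.fourierInv_toTemperedDistribution_eq] at hU
  have hloc : LocallyIntegrable (𝓕⁻ T : Lp ℂ 2 (volume : Measure V)) :=
    (Lp.memLp _).locallyIntegrable (by norm_num)
  refine ae_eq_of_integral_schwartz_mul_eq ((Lp.memLp _).locallyIntegrable (by norm_num)) ?_ ?_
  · have hc : Continuous fun ξ : V => -(2 * Real.pi * Complex.I) * ((inner ℝ ξ m : ℝ) : ℂ) := by
      fun_prop
    rw [← locallyIntegrableOn_univ] at hloc ⊢
    exact hloc.continuousOn_mul hc.continuousOn isOpen_univ.isLocallyClosed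
  · intro φ
    have h1 := congrArg (fun S : 𝓢'(V, ℂ) => S φ) hU
    have hg : (fun x : V => ((inner ℝ x m : ℝ) : ℂ)).HasTemperateGrowth := by fun_prop
    simp only [TemperedDistribution.smulLeftCLM_apply_apply, Lp.toTemperedDistribution_apply,
      smul_eq_mul, smul_apply] at h1
    rw [← h1, ← integral_const_mul]
    refine integral_congr_ae (Eventually.of_forall fun x => ?_)
    simp only [SchwartzMap.smulLeftCLM_apply_apply hg, smul_eq_mul]
    ring

end FourierL2

/-! ### Integration by parts against Schwartz functions. -/

section WeakGradient

variable {N : ℕ}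

theorem memLp_inner_const (g : Lp (RSpace N) 2 (volume : Measure (RSpace N))) (v : RSpace N) :
    MemLp (fun x => (inner ℝ (g x) v : ℝ)) 2 (volume : Measure (RSpace N)) :=
  (Lp.memLp g).inner_const v

theorem integrable_ofReal_mul {f : RSpace N → ℝ} {ψ : RSpace N → ℂ} (hf : MemLp f 2)
    (hψ : MemLp ψ 2) : Integrable (fun x => ψ x * (f x : ℂ)) := by
  have : MemLp (fun x => (f x : ℂ)) 2 (volume : Measure (RSpace N)) := hf.ofReal
  exact hψ.integrable_mul this

/-- Integration by parts against complex test functions with compact support. -/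
theorem weakGradient_complex (w : H1 N) {ψ : RSpace N → ℂ} (hψ : ContDiff ℝ ∞ ψ)
    (hs : HasCompactSupport ψ) (v : RSpace N) :
    ∫ x, fderiv ℝ ψ x v * (w.fn x : ℂ) = - ∫ x, ψ x * ((inner ℝ (w.grad x) v : ℝ) : ℂ) := by
  have hc : Continuous (fun x => fderiv ℝ ψ x v) :=
    (hψ.continuous_fderiv (by simp)).clm_apply continuous_const
  have hw : MemLp w.fn 2 (volume : Measure (RSpace N)) := Lp.memLp w.1.fst
  have i1 := integrable_ofReal_mul hw
    (hc.memLp_of_hasCompactSupport (p := 2) (hs.fderiv_apply ℝ v))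
  have i2 := integrable_ofReal_mul (memLp_inner_const w.grad v)
    (hψ.continuous.memLp_of_hasCompactSupport (p := 2) hs)
  have hd : ∀ x, DifferentiableAt ℝ ψ x := fun x =>
    (hψ.differentiable (by simp)) x
  -- The weak gradient tests only real functions; real and imaginary parts of $\psi$ are treated
  -- together through a real functional $L$ that pulls out real factors.
  have key : ∀ L : ℂ →L[ℝ] ℝ, (∀ (z : ℂ) (r : ℝ), L (z * r) = r * L z) →
      L (∫ x, fderiv ℝ ψ x v * (w.fn x : ℂ)) =
        L (- ∫ x, ψ x * ((inner ℝ (w.grad x) v : ℝ) : ℂ)) := by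
    intro L hL
    have h := w.2 (L ∘ ψ) (L.contDiff.comp hψ) (hs.comp_left (map_zero L)) v
    rw [map_neg, ← L.integral_comp_comm i1, ← L.integral_comp_comm i2]
    simp only [hL]
    have e : ∀ x, fderiv ℝ (L ∘ ψ) x v = L (fderiv ℝ ψ x v) := fun x => by
      rw [(L.hasFDerivAt.comp x (hd x).hasFDerivAt).fderiv]; rfl
    simp only [e] at h
    exact h
  refine Complex.ext (key Complex.reCLM ?_) (key Complex.imCLM ?_)
  · intro z r; simp [mul_comm]
  · intro z r; simp [mul_comm]

/-- Smooth cutoff functions that increase to `1` with gradients tending to `0`. -/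
theorem exists_smooth_cutoff (N : ℕ) : ∃ η : ℕ → RSpace N → ℝ, (∀ n, ContDiff ℝ ∞ (η n)) ∧
    (∀ n, HasCompactSupport (η n)) ∧ (∀ n x, |η n x| ≤ 1) ∧
    (∀ x, Tendsto (fun n => η n x) atTop (𝓝 1)) ∧
    ∃ C, (∀ n x, ‖fderiv ℝ (η n) x‖ ≤ C) ∧
      ∀ x v, Tendsto (fun n => fderiv ℝ (η n) x v) atTop (𝓝 0) := by
  let χ : ContDiffBump (0 : RSpace N) := ⟨1, 2, by norm_num, by norm_num⟩
  have hχ : ContDiff ℝ ∞ χ := χ.contDiff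
  let c : ℕ → ℝ := fun n => (n + 1 : ℝ)⁻¹
  have hc0 : ∀ n, c n ≠ 0 := fun n => by positivity
  have hcle : ∀ n, |c n| ≤ 1 := fun n => by
    rw [abs_of_nonneg (by positivity)]
    exact inv_le_one_of_one_le₀ (by linarith [n.cast_nonneg (α := ℝ)])
  have hclim : Tendsto c atTop (𝓝 0) := tendsto_inv_atTop_zero.comp
    (tendsto_atTop_add_const_right _ _ tendsto_natCast_atTop_atTop)
  obtain ⟨C, hC⟩ : ∃ C, ∀ x, ‖fderiv ℝ χ x‖ ≤ C :=
    (hχ.continuous_fderiv (by simp)).bounded_above_of_compact_support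
      (χ.hasCompactSupport.fderiv ℝ)
  have hC0 : 0 ≤ C := (norm_nonneg _).trans (hC 0)
  have hder : ∀ n x, fderiv ℝ (fun x => χ (c n • x)) x = c n • fderiv ℝ χ (c n • x) := by
    intro n x
    have h1 : HasFDerivAt (fun x => χ (c n • x))
        ((fderiv ℝ χ (c n • x)).comp (c n • ContinuousLinearMap.id ℝ _)) x :=
      ((hχ.differentiable (by simp)) (c n • x)).hasFDerivAt.comp x
        ((hasFDerivAt_id x).const_smul (c n))
    rw [h1.fderiv]
    ext v
    simp
  refine ⟨fun n x => χ (c n • x), fun n => hχ.comp (contDiff_const_smul (c n)),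
    fun n => χ.hasCompactSupport.comp_smul (hc0 n), fun n x => ?_, fun x => ?_, C,
    fun n x => ?_, fun x v => ?_⟩
  · rw [abs_of_nonneg χ.nonneg]; exact χ.le_one
  · have : Tendsto (fun n => c n • x) atTop (𝓝 0) := by simpa using hclim.smul_const x
    have h := (χ.continuous.tendsto 0).comp this
    rw [χ.one_of_mem_closedBall (by simp [χ])] at h
    exact h
  · rw [hder, norm_smul]
    calc ‖c n‖ * ‖fderiv ℝ χ (c n • x)‖ ≤ 1 * C := by
          gcongr
          · exact hcle n
          · exact hC _
      _ = C := one_mul _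
  · simp only [hder]
    refine bdd_le_mul_tendsto_zero' (C * ‖v‖) ?_ hclim |>.congr fun n => mul_comm _ _
    exact Eventually.of_forall fun n =>
      ((fderiv ℝ χ (c n • x)).le_opNorm v).trans (by gcongr; exact hC _)

/-- Integration by parts against Schwartz functions. -/
theorem weakGradient_schwartz (w : H1 N) (φ : 𝓢(RSpace N, ℂ)) (v : RSpace N) :
    ∫ x, (∂_{v} φ) x * (w.fn x : ℂ) = - ∫ x, φ x * ((inner ℝ (w.grad x) v : ℝ) : ℂ) := by
  obtain ⟨η, hη, hηs, hη1, hlim, C, hC, hlim'⟩ := exists_smooth_cutoff N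
  have hψ : ∀ n, ContDiff ℝ ∞ (fun x => (η n x : ℂ) * φ x) := fun n =>
    (Complex.ofRealCLM.contDiff.comp (hη n)).mul φ.smooth'
  have hψs : ∀ n, HasCompactSupport (fun x => (η n x : ℂ) * φ x) := fun n =>
    ((hηs n).comp_left (g := ((↑) : ℝ → ℂ)) Complex.ofReal_zero).mul_right
  have hder : ∀ n x, fderiv ℝ (fun x => (η n x : ℂ) * φ x) x v =
      (η n x : ℂ) * (∂_{v} φ) x + ((fderiv ℝ (η n) x v : ℝ) : ℂ) * φ x := by
    intro n x
    have h1 : HasFDerivAt (η n) (fderiv ℝ (η n) x) x :=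
      ((hη n).differentiable (by simp) x).hasFDerivAt
    have h3 : HasFDerivAt (fun x => (η n x : ℂ) * φ x) _ x :=
      (Complex.ofRealCLM.hasFDerivAt.comp x h1).mul (φ.differentiableAt (x := x)).hasFDerivAt
    rw [h3.fderiv, SchwartzMap.lineDerivOp_apply_eq_fderiv]
    simp [mul_comm]
  have hw : MemLp w.fn 2 (volume : Measure (RSpace N)) := Lp.memLp w.1.fst
  have hg := memLp_inner_const w.grad v
  have hlim1 : ∀ x, Tendsto (fun n => ((η n x : ℝ) : ℂ)) atTop (𝓝 1) := fun x => by
    have := (Complex.continuous_ofReal.tendsto 1).comp (hlim x)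
    rwa [Complex.ofReal_one] at this
  have hlim2 : ∀ x, Tendsto (fun n => ((fderiv ℝ (η n) x v : ℝ) : ℂ)) atTop (𝓝 0) := fun x => by
    have := (Complex.continuous_ofReal.tendsto 0).comp (hlim' x v)
    rwa [Complex.ofReal_zero] at this
  -- The product rule adds a term with $\nabla\eta_n$; it is bounded by $C\|v\|$ and vanishes
  -- pointwise in the limit.
  have L1 : Tendsto (fun n => ∫ x, fderiv ℝ (fun x => (η n x : ℂ) * φ x) x v * (w.fn x : ℂ)) atTop
      (𝓝 (∫ x, (∂_{v} φ) x * (w.fn x : ℂ))) := by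
    refine tendsto_integral_of_dominated_convergence
      (fun x => ‖(∂_{v} φ) x * (w.fn x : ℂ)‖ + (C * ‖v‖) * ‖φ x * (w.fn x : ℂ)‖) ?_ ?_ ?_ ?_
    · intro n
      have hcont : Continuous (fun x => fderiv ℝ (fun x => (η n x : ℂ) * φ x) x v) :=
        ((hψ n).continuous_fderiv (by simp)).clm_apply continuous_const
      exact hcont.aestronglyMeasurable.mul hw.ofReal.1
    · exact (integrable_ofReal_mul hw ((∂_{v} φ).memLp 2)).norm.add
        ((integrable_ofReal_mul hw (φ.memLp 2)).norm.const_mul _)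
    · intro n
      refine Eventually.of_forall fun x => ?_
      rw [hder, add_mul]
      refine (norm_add_le _ _).trans (add_le_add ?_ ?_)
      · rw [mul_assoc, norm_mul]
        refine mul_le_of_le_one_left (norm_nonneg _) ?_
        rw [Complex.norm_real]; exact hη1 _ _
      · rw [mul_assoc, norm_mul]
        refine mul_le_mul_of_nonneg_right ?_ (norm_nonneg _)
        rw [Complex.norm_real]
        exact ((fderiv ℝ (η n) x).le_opNorm v).trans
          (mul_le_mul_of_nonneg_right (hC _ _) (norm_nonneg _))
    · refine Eventually.of_forall fun x => ?_
      have h := (((hlim1 x).mul_const ((∂_{v} φ) x)).add ((hlim2 x).mul_const (φ x))).mul_const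
        (w.fn x : ℂ)
      rw [one_mul, zero_mul, add_zero] at h
      exact h.congr fun n => by rw [hder]
  have L2 : Tendsto (fun n => ∫ x, ((η n x : ℂ) * φ x) * ((inner ℝ (w.grad x) v : ℝ) : ℂ)) atTop
      (𝓝 (∫ x, φ x * ((inner ℝ (w.grad x) v : ℝ) : ℂ))) := by
    refine tendsto_integral_of_dominated_convergence
      (fun x => ‖φ x * ((inner ℝ (w.grad x) v : ℝ) : ℂ)‖) ?_ ?_ ?_ ?_
    · exact fun n => (hψ n).continuous.aestronglyMeasurable.mul hg.ofReal.1
    · exact (integrable_ofReal_mul hg (φ.memLp 2)).norm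
    · intro n
      refine Eventually.of_forall fun x => ?_
      rw [mul_assoc, norm_mul]
      refine mul_le_of_le_one_left (norm_nonneg _) ?_
      rw [Complex.norm_real]; exact hη1 _ _
    · refine Eventually.of_forall fun x => ?_
      have h := ((hlim1 x).mul_const (φ x)).mul_const ((inner ℝ (w.grad x) v : ℝ) : ℂ)
      rwa [one_mul] at h
  refine tendsto_nhds_unique L1 (L2.neg.congr fun n => ?_)
  exact (weakGradient_complex w (hψ n) (hψs n) v).symm

end WeakGradient

/-! ### Plancherel for the gradient and the low/high frequency splitting. -/

section Spectrum

theorem lintegral_enorm_sq_eq {α F : Type*} [MeasurableSpace α] {μ : Measure α}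
    [NormedAddCommGroup F] (f : Lp F 2 μ) :
    ∫⁻ x, ‖f x‖ₑ ^ 2 ∂μ = ENNReal.ofReal (‖f‖ ^ 2) := by
  have h := eLpNorm_nnreal_pow_eq_lintegral (f := f) (μ := μ) (p := 2) (by norm_num)
  rw [ENNReal.ofReal_pow (norm_nonneg _), Lp.norm_def, ENNReal.ofReal_toReal (Lp.eLpNorm_ne_top f)]
  simp only [NNReal.coe_ofNat, ENNReal.coe_ofNat, ENNReal.rpow_ofNat] at h
  exact h.symm

variable {N : ℕ}

/-- Complexification of real `L²` functions. -/
noncomputable def complexify (N : ℕ) : Lp ℝ 2 (volume : Measure (RSpace N)) →L[ℝ]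
    Lp ℂ 2 (volume : Measure (RSpace N)) :=
  Complex.ofRealCLM.compLpL 2 volume

theorem coeFn_complexify (f : Lp ℝ 2 (volume : Measure (RSpace N))) :
    complexify N f =ᵐ[volume] fun x => (f x : ℂ) :=
  Complex.ofRealCLM.coeFn_compLpL f

theorem norm_complexify (f : Lp ℝ 2 (volume : Measure (RSpace N))) :
    ‖complexify N f‖ = ‖f‖ := by
  rw [Lp.norm_def, Lp.norm_def]
  congr 1
  refine eLpNorm_congr_norm_ae ?_
  filter_upwards [coeFn_complexify f] with x hx
  rw [hx, Complex.norm_real]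

/-- The inverse Fourier transform of an `H¹` function. -/
noncomputable def H1.spec (w : H1 N) : Lp ℂ 2 (volume : Measure (RSpace N)) :=
  𝓕⁻ (complexify N w.1.fst)

theorem H1.norm_spec (w : H1 N) : ‖w.spec‖ = ‖w.1.fst‖ := by
  rw [← norm_complexify w.1.fst]
  exact (Lp.fourierTransformₗᵢ (RSpace N) ℂ).symm.norm_map _

/-- `H1.spec` as a continuous linear map. -/
noncomputable def H1.specCLM (N : ℕ) : H1 N →L[ℝ] Lp ℂ 2 (volume : Measure (RSpace N)) :=
  (((Lp.fourierTransformₗᵢ (RSpace N) ℂ).symm.toContinuousLinearEquiv :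
      Lp ℂ 2 (volume : Measure (RSpace N)) →L[ℂ] _).restrictScalars ℝ) ∘L complexify N ∘L
    (WithLp.fstL 2 ℝ _ _) ∘L (sobolevH1 N).subtypeL

/-- A component of the gradient as an `L²` function. -/
noncomputable def H1.gradComp (w : H1 N) (v : RSpace N) : Lp ℝ 2 (volume : Measure (RSpace N)) :=
  (memLp_inner_const w.grad v).toLp _

theorem H1.coeFn_gradComp (w : H1 N) (v : RSpace N) :
    w.gradComp v =ᵐ[volume] fun x => inner ℝ (w.grad x) v :=
  MemLp.coeFn_toLp _

/-- Integration by parts extended to Schwartz functions makes the component a derivative in the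
tempered sense, hence a Fourier multiplier. Summing its square over a basis yields Plancherel for
$\nabla w$. -/
theorem H1.fourierInv_gradComp (w : H1 N) (v : RSpace N) :
    (𝓕⁻ (complexify N (w.gradComp v)) : Lp ℂ 2 (volume : Measure (RSpace N))) =ᵐ[volume]
      fun ξ => -(2 * Real.pi * Complex.I) * (inner ℝ ξ v : ℝ) * w.spec ξ := by
  refine Lp_fourierInv_ae_eq_of_lineDeriv fun φ => ?_
  have h1 : ∫ x, (∂_{v} φ) x * complexify N w.1.fst x = ∫ x, (∂_{v} φ) x * (w.fn x : ℂ) := by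
    refine integral_congr_ae ?_
    filter_upwards [coeFn_complexify w.1.fst] with x hx
    rw [hx]; rfl
  have h2 : ∫ x, φ x * complexify N (w.gradComp v) x =
      ∫ x, φ x * ((inner ℝ (w.grad x) v : ℝ) : ℂ) := by
    refine integral_congr_ae ?_
    filter_upwards [coeFn_complexify (w.gradComp v), w.coeFn_gradComp v] with x hx hx'
    rw [hx, hx']
  rw [h1, h2, weakGradient_schwartz]

/-- Plancherel's theorem for the gradient. -/
theorem H1.lintegral_spec_grad (w : H1 N) :
    ∫⁻ ξ, ENNReal.ofReal ((2 * Real.pi * ‖ξ‖) ^ 2) * ‖w.spec ξ‖ₑ ^ 2 =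
      ENNReal.ofReal (‖w.grad‖ ^ 2) := by
  let b := EuclideanSpace.basisFun (Fin N) ℝ
  let W : Fin N → Lp ℂ 2 (volume : Measure (RSpace N)) := fun j =>
    𝓕⁻ (complexify N (w.gradComp (b j)))
  have hW : ∀ j, ‖W j‖ = ‖w.gradComp (b j)‖ := fun j => by
    rw [← norm_complexify]
    exact (Lp.fourierTransformₗᵢ (RSpace N) ℂ).symm.norm_map _
  have hsum : ∀ y : RSpace N, ∑ j, (inner ℝ y (b j)) ^ 2 = ‖y‖ ^ 2 := fun y => by
    rw [← b.sum_sq_norm_inner_left y]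
    simp [Real.norm_eq_abs, sq_abs]
  calc ∫⁻ ξ, ENNReal.ofReal ((2 * Real.pi * ‖ξ‖) ^ 2) * ‖w.spec ξ‖ₑ ^ 2
      = ∫⁻ ξ, ∑ j, ‖W j ξ‖ₑ ^ 2 := by
        refine lintegral_congr_ae ?_
        have : ∀ᵐ ξ, ∀ j, W j ξ = -(2 * Real.pi * Complex.I) * (inner ℝ ξ (b j) : ℝ) * w.spec ξ :=
          ae_all_iff.2 fun j => w.fourierInv_gradComp (b j)
        filter_upwards [this] with ξ hξ
        have e : ∀ j, ‖W j ξ‖ₑ ^ 2 =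
            ENNReal.ofReal ((2 * Real.pi) ^ 2 * (inner ℝ ξ (b j)) ^ 2) * ‖w.spec ξ‖ₑ ^ 2 := by
          intro j
          rw [hξ j, enorm_mul, mul_pow]
          congr 1
          rw [← ofReal_norm, ← ENNReal.ofReal_pow (norm_nonneg _)]
          congr 1
          simp [mul_pow, abs_of_pos Real.pi_pos]
        simp only [e]
        rw [← Finset.sum_mul, ← ENNReal.ofReal_sum_of_nonneg (fun j _ => by positivity),
          ← Finset.mul_sum, hsum, mul_pow _ ‖ξ‖]
    _ = ∑ j, ENNReal.ofReal (‖w.gradComp (b j)‖ ^ 2) := by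
        rw [lintegral_finsetSum' _ fun j _ => by
          exact (Lp.aestronglyMeasurable (W j)).enorm.pow_const 2]
        exact Finset.sum_congr rfl fun j _ => by rw [lintegral_enorm_sq_eq, hW]
    _ = ∫⁻ x, ∑ j, ‖w.gradComp (b j) x‖ₑ ^ 2 := by
        rw [lintegral_finsetSum' _ fun j _ => by
          exact (Lp.aestronglyMeasurable (w.gradComp (b j))).enorm.pow_const 2]
        exact Finset.sum_congr rfl fun j _ => by rw [lintegral_enorm_sq_eq]
    _ = ∫⁻ x, ‖w.grad x‖ₑ ^ 2 := by
        refine lintegral_congr_ae ?_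
        have : ∀ᵐ x, ∀ j, w.gradComp (b j) x = inner ℝ (w.grad x) (b j) :=
          ae_all_iff.2 fun j => w.coeFn_gradComp (b j)
        filter_upwards [this] with x hx
        simp only [hx, ← ofReal_norm, ← ENNReal.ofReal_pow (norm_nonneg _)]
        rw [← ENNReal.ofReal_sum_of_nonneg (fun j _ => by positivity)]
        simp only [Real.norm_eq_abs, sq_abs, hsum]
    _ = _ := lintegral_enorm_sq_eq _

/-- The part of `w` with frequencies in the ball of radius `ρ`. -/
noncomputable def H1.lowPart (ρ : ℝ) (w : H1 N) : RSpace N → ℂ :=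
  𝓕 ((Metric.ball 0 ρ).indicator w.spec)

theorem H1.integrable_indicator_spec (ρ : ℝ) (w : H1 N) :
    Integrable ((Metric.ball 0 ρ).indicator w.spec) := by
  rw [integrable_indicator_iff Metric.isOpen_ball.measurableSet]
  have : IsFiniteMeasure (volume.restrict (Metric.ball (0 : RSpace N) ρ)) :=
    ⟨by simpa using Metric.isBounded_ball.measure_lt_top⟩
  exact ((Lp.memLp w.spec).restrict _).integrable (by norm_num)

theorem H1.norm_lowPart_le (ρ : ℝ) (w : H1 N) (x : RSpace N) :
    ‖w.lowPart ρ x‖ ≤ ∫ ξ in Metric.ball 0 ρ, ‖w.spec ξ‖ := by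
  refine (VectorFourier.norm_fourierIntegral_le_integral_norm _ _ _ _ _).trans_eq ?_
  rw [← integral_indicator Metric.isOpen_ball.measurableSet]
  simp only [norm_indicator_eq_indicator_norm]

/-- Splitting into low frequencies and a remainder that is small in `L²`. -/
theorem H1.exists_lowPart_add (w : H1 N) {ρ : ℝ} (hρ : 0 < ρ) :
    ∃ q : Lp ℂ 2 (volume : Measure (RSpace N)),
      (∀ᵐ x, (w.fn x : ℂ) = w.lowPart ρ x + q x) ∧
      ∫⁻ x, ‖q x‖ₑ ^ 2 ≤ ENNReal.ofReal (‖w.grad‖ ^ 2 / (2 * Real.pi * ρ) ^ 2) := by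
  set B : Set (RSpace N) := Metric.ball 0 ρ
  have hB : MeasurableSet B := Metric.isOpen_ball.measurableSet
  let Ul : Lp ℂ 2 (volume : Measure (RSpace N)) := ((Lp.memLp w.spec).indicator hB).toLp _
  have hUl : Ul =ᵐ[volume] B.indicator w.spec := MemLp.coeFn_toLp _
  refine ⟨𝓕 (w.spec - Ul), ?_, ?_⟩
  · have h1 : 𝓕 w.spec = complexify N w.1.fst :=
      (Lp.fourierTransformₗᵢ (RSpace N) ℂ).apply_symm_apply _
    have h2 : (𝓕 Ul : Lp ℂ 2 (volume : Measure (RSpace N))) =ᵐ[volume] w.lowPart ρ := by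
      refine (Lp_fourier_ae_eq_integral Ul
        ((w.integrable_indicator_spec ρ).congr hUl.symm)).trans (Eventually.of_forall fun x => ?_)
      refine integral_congr_ae ?_
      filter_upwards [hUl] with ξ hξ
      rw [hξ]
    have h3 : (𝓕 (w.spec - Ul) : Lp ℂ 2 (volume : Measure (RSpace N))) = 𝓕 w.spec - 𝓕 Ul :=
      (Lp.fourierTransformₗᵢ (RSpace N) ℂ).map_sub _ _
    rw [h3, h1]
    filter_upwards [h2, coeFn_complexify w.1.fst, Lp.coeFn_sub (complexify N w.1.fst) (𝓕 Ul)]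
      with x a1 a2 a3
    rw [a3, Pi.sub_apply, a1, a2, add_sub_cancel]
    rfl
  -- The remainder lives on $|\xi|\ge\rho$, where $(2\pi\rho)^2\le(2\pi|\xi|)^2$; Plancherel then
  -- compares it with the gradient.
  · rw [lintegral_enorm_sq_eq, Lp.norm_fourier_eq, ← lintegral_enorm_sq_eq,
      ENNReal.ofReal_div_of_pos (by positivity), ENNReal.le_div_iff_mul_le
      (Or.inl (by simpa using by positivity)) (Or.inl ENNReal.ofReal_ne_top),
      ← w.lintegral_spec_grad, ← lintegral_mul_const' _ _ ENNReal.ofReal_ne_top]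
    refine lintegral_mono_ae ?_
    filter_upwards [hUl, Lp.coeFn_sub w.spec Ul] with ξ h1 h2
    rw [h2, Pi.sub_apply, h1, mul_comm]
    by_cases hξ : ξ ∈ B
    · simp [hξ]
    · have : ρ ≤ ‖ξ‖ := by simpa [B] using hξ
      rw [Set.indicator_of_notMem hξ, sub_zero]
      gcongr

/-- Evaluation of the low frequency part at a point is a continuous linear functional. -/
theorem H1.exists_lowPart_clm (ρ : ℝ) (x : RSpace N) :
    ∃ ℓ : H1 N →L[ℝ] ℂ, ∀ w : H1 N, ℓ w = w.lowPart ρ x := by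
  set B : Set (RSpace N) := Metric.ball 0 ρ
  have hB : MeasurableSet B := Metric.isOpen_ball.measurableSet
  -- The exponent has a plus sign because the inner product conjugates its first argument.
  let k : RSpace N → ℂ := fun ξ => ((Real.fourierChar (inner ℝ ξ x) : Circle) : ℂ)
  have hk : Continuous k :=
    continuous_subtype_val.comp (Real.continuous_fourierChar.comp (by fun_prop))
  have hkm : MemLp (B.indicator k) 2 (volume : Measure (RSpace N)) := by
    rw [memLp_indicator_iff_restrict hB]
    have : IsFiniteMeasure (volume.restrict B) :=
      ⟨by simpa [B] using Metric.isBounded_ball.measure_lt_top⟩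
    exact MemLp.of_bound hk.aestronglyMeasurable 1 (Eventually.of_forall fun ξ => (Circle.norm_coe _).le)
  refine ⟨((innerSL ℂ (hkm.toLp _)).restrictScalars ℝ) ∘L H1.specCLM N, fun w => ?_⟩
  change inner ℂ (hkm.toLp _) w.spec = _
  rw [L2.inner_def, H1.lowPart, Real.fourier_eq]
  refine integral_congr_ae ?_
  filter_upwards [hkm.coeFn_toLp] with ξ hξ
  rw [hξ]
  by_cases h : ξ ∈ B
  · simp [h, k, B, Circle.smul_def, RCLike.inner_apply, AddChar.map_neg_eq_inv, mul_comm,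
      ← Circle.coe_inv_eq_conj]
  · simp [h, B]

end Spectrum

/-! ### Trudinger–Moser inequalities in the plane. -/

section TrudingerMoser

theorem integral_Ioo_div_sq_add {ρ l : ℝ} (hρ : 0 < ρ) (hl : 0 < l) :
    ∫ y in Set.Ioo 0 ρ, y * ((2 * Real.pi * y) ^ 2 + l)⁻¹ =
      (8 * Real.pi ^ 2)⁻¹ * Real.log (1 + (2 * Real.pi * ρ) ^ 2 / l) := by
  have hpos : ∀ y : ℝ, 0 < (2 * Real.pi * y) ^ 2 + l := fun y => by positivity
  have hd : ∀ y : ℝ, HasDerivAt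
      (fun y => (8 * Real.pi ^ 2)⁻¹ * Real.log ((2 * Real.pi * y) ^ 2 + l))
      (y * ((2 * Real.pi * y) ^ 2 + l)⁻¹) y := by
    intro y
    have h1 : HasDerivAt (fun y : ℝ => (2 * Real.pi * y) ^ 2 + l)
        (2 * (2 * Real.pi * y) * (2 * Real.pi)) y := by
      simpa using ((((hasDerivAt_id y).const_mul (2 * Real.pi)).pow 2).add_const l)
    refine ((h1.log (hpos y).ne').const_mul (8 * Real.pi ^ 2)⁻¹).congr_deriv ?_
    have := Real.pi_pos
    have := (hpos y).ne'
    field_simp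
    ring
  have hc : Continuous fun y : ℝ => y * ((2 * Real.pi * y) ^ 2 + l)⁻¹ :=
    continuous_id.mul (Continuous.inv₀ (by fun_prop) fun y => (hpos y).ne')
  rw [← integral_Ioc_eq_integral_Ioo, ← intervalIntegral.integral_of_le hρ.le,
    intervalIntegral.integral_eq_sub_of_hasDerivAt (fun y _ => hd y) (hc.intervalIntegrable _ _),
    ← mul_sub, ← Real.log_div (hpos ρ).ne' (hpos 0).ne']
  congr 2
  field_simp
  ring

/-- The logarithmic growth of the Bessel kernel's symbol in the plane. -/
theorem lintegral_ball_symbol {ρ l : ℝ} (hρ : 0 < ρ) (hl : 0 < l) :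
    ∫⁻ ξ in Metric.ball (0 : RSpace 2) ρ, ENNReal.ofReal (((2 * Real.pi * ‖ξ‖) ^ 2 + l)⁻¹) =
      ENNReal.ofReal ((4 * Real.pi)⁻¹ * Real.log (1 + (2 * Real.pi * ρ) ^ 2 / l)) := by
  have hpos : ∀ y : ℝ, 0 < (2 * Real.pi * y) ^ 2 + l := fun y => by positivity
  have hB : MeasurableSet (Metric.ball (0 : RSpace 2) ρ) := Metric.isOpen_ball.measurableSet
  have hc : Continuous fun ξ : RSpace 2 => ((2 * Real.pi * ‖ξ‖) ^ 2 + l)⁻¹ :=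
    Continuous.inv₀ (by fun_prop) fun y => (hpos _).ne'
  have hint : IntegrableOn (fun ξ : RSpace 2 => ((2 * Real.pi * ‖ξ‖) ^ 2 + l)⁻¹)
      (Metric.ball 0 ρ) :=
    (hc.continuousOn.integrableOn_compact (isCompact_closedBall 0 ρ)).mono_set
      Metric.ball_subset_closedBall
  rw [← ofReal_integral_eq_lintegral_ofReal hint
    (Eventually.of_forall fun ξ => (inv_pos.2 (hpos _)).le)]
  congr 1
  -- Polar coordinates: the factor $2\pi\cdot(8\pi^2)^{-1}=(4\pi)^{-1}$ is the origin of the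
  -- threshold $4\pi$.
  have h := integral_fun_norm_addHaar (volume : Measure (RSpace 2))
    ((Set.Iio ρ).indicator fun y : ℝ => ((2 * Real.pi * y) ^ 2 + l)⁻¹)
  have e1 : ∫ ξ in Metric.ball (0 : RSpace 2) ρ, ((2 * Real.pi * ‖ξ‖) ^ 2 + l)⁻¹ =
      ∫ ξ : RSpace 2, (Set.Iio ρ).indicator (fun y : ℝ => ((2 * Real.pi * y) ^ 2 + l)⁻¹) ‖ξ‖ := by
    rw [← integral_indicator hB]
    congr 1 with ξ
    by_cases hy : ‖ξ‖ < ρ <;> simp [hy]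
  have e2 : ∫ y in Set.Ioi (0 : ℝ), y ^ (Module.finrank ℝ (RSpace 2) - 1) •
      (Set.Iio ρ).indicator (fun y : ℝ => ((2 * Real.pi * y) ^ 2 + l)⁻¹) y =
      ∫ y in Set.Ioo 0 ρ, y * ((2 * Real.pi * y) ^ 2 + l)⁻¹ := by
    have : Set.Ioo 0 ρ = Set.Ioi 0 ∩ Set.Iio ρ := rfl
    rw [this, ← setIntegral_indicator measurableSet_Iio]
    congr 1 with y
    by_cases hy : y < ρ <;> simp [hy]
  have hv : (volume : Measure (RSpace 2)).real (Metric.ball 0 1) = Real.pi := by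
    simp [Measure.real, EuclideanSpace.volume_ball_fin_two, Real.pi_pos.le]
  rw [e1, h, e2, integral_Ioo_div_sq_add hρ hl, hv]
  have := Real.pi_pos
  simp only [finrank_euclideanSpace, Fintype.card_fin, nsmul_eq_mul, smul_eq_mul]
  push_cast
  field_simp
  ring

/-- The Cauchy–Schwarz bound for the low frequencies. -/
theorem H1.lintegral_spec_le (w : H1 2) {ρ l S : ℝ} (hρ : 0 < ρ) (hl : 0 < l) (hS : 0 ≤ S)
    {T : Set (RSpace 2)}
    (hT : ∫⁻ ξ in T, ENNReal.ofReal ((2 * Real.pi * ‖ξ‖) ^ 2 + l) * ‖w.spec ξ‖ₑ ^ 2 ≤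
      ENNReal.ofReal S) :
    ∫⁻ ξ in Metric.ball 0 ρ ∩ T, ‖w.spec ξ‖ₑ ≤
      ENNReal.ofReal √(S / (4 * Real.pi) * Real.log (1 + (2 * Real.pi * ρ) ^ 2 / l)) := by
  set L := Real.log (1 + (2 * Real.pi * ρ) ^ 2 / l)
  have hpos : ∀ y : ℝ, 0 < (2 * Real.pi * y) ^ 2 + l := fun y => by positivity
  set p : RSpace 2 → ENNReal := fun ξ => ENNReal.ofReal √((2 * Real.pi * ‖ξ‖) ^ 2 + l)
  have hp : ∀ ξ, p ξ ^ 2 = ENNReal.ofReal ((2 * Real.pi * ‖ξ‖) ^ 2 + l) := fun ξ => by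
    rw [← ENNReal.ofReal_pow (Real.sqrt_nonneg _), Real.sq_sqrt (hpos _).le]
  have hp0 : ∀ ξ, p ξ ≠ 0 := fun ξ => by simpa [p] using hpos ‖ξ‖
  have hpm : Measurable p := by fun_prop
  set μ := (volume : Measure (RSpace 2)).restrict (Metric.ball 0 ρ ∩ T)
  -- Cauchy–Schwarz for $|\hat w|=(p|\hat w|)\cdot p^{-1}$, with $p^2$ the symbol $(2\pi|\xi|)^2+l$.
  have hCS := ENNReal.lintegral_mul_le_Lp_mul_Lq μ Real.HolderConjugate.two_two
    (f := fun ξ => p ξ * ‖w.spec ξ‖ₑ) (g := fun ξ => (p ξ)⁻¹)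
    (hpm.aemeasurable.mul (Lp.aestronglyMeasurable w.spec).enorm.restrict)
    hpm.inv.aemeasurable
  have e1 : ∫⁻ ξ, ((fun ξ => p ξ * ‖w.spec ξ‖ₑ) * fun ξ => (p ξ)⁻¹) ξ ∂μ =
      ∫⁻ ξ, ‖w.spec ξ‖ₑ ∂μ := by
    refine lintegral_congr fun ξ => ?_
    simp only [Pi.mul_apply]
    rw [mul_right_comm, ENNReal.mul_inv_cancel (hp0 ξ) ENNReal.ofReal_ne_top, one_mul]
  rw [e1] at hCS
  refine hCS.trans ?_
  have hmul : ∀ ξ, (p ξ * ‖w.spec ξ‖ₑ) ^ 2 =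
      ENNReal.ofReal ((2 * Real.pi * ‖ξ‖) ^ 2 + l) * ‖w.spec ξ‖ₑ ^ 2 := fun ξ => by
    rw [mul_pow, hp]
  simp only [ENNReal.rpow_ofNat, hmul, ← ENNReal.inv_pow, hp]
  have b1 : ∫⁻ ξ, ENNReal.ofReal ((2 * Real.pi * ‖ξ‖) ^ 2 + l) * ‖w.spec ξ‖ₑ ^ 2 ∂μ ≤
      ENNReal.ofReal S := (lintegral_mono_set Set.inter_subset_right).trans hT
  have b2 : ∫⁻ ξ, (ENNReal.ofReal ((2 * Real.pi * ‖ξ‖) ^ 2 + l))⁻¹ ∂μ ≤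
      ENNReal.ofReal ((4 * Real.pi)⁻¹ * L) := by
    rw [← lintegral_ball_symbol hρ hl]
    refine (lintegral_mono_set Set.inter_subset_left).trans_eq ?_
    simp only [ENNReal.ofReal_inv_of_pos (hpos _)]
  have hL : 0 ≤ L := Real.log_nonneg (by
    have : 0 ≤ (2 * Real.pi * ρ) ^ 2 / l := by positivity
    linarith)
  have hpi := Real.pi_pos
  calc _ ≤ ENNReal.ofReal S ^ (1 / 2 : ℝ) * ENNReal.ofReal ((4 * Real.pi)⁻¹ * L) ^ (1 / 2 : ℝ) := by
        gcongr
    _ = _ := by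
        rw [← ENNReal.mul_rpow_of_nonneg _ _ (by norm_num), ← ENNReal.ofReal_mul hS,
          ENNReal.ofReal_rpow_of_nonneg (by positivity) (by norm_num), ← Real.sqrt_eq_rpow]
        congr 2
        field_simp

theorem H1.setIntegral_norm_spec (w : H1 2) (ρ : ℝ) :
    ENNReal.ofReal (∫ ξ in Metric.ball 0 ρ, ‖w.spec ξ‖) =
      ∫⁻ ξ in Metric.ball 0 ρ, ‖w.spec ξ‖ₑ := by
  have := (integrable_indicator_iff Metric.isOpen_ball.measurableSet).1
    (w.integrable_indicator_spec ρ)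
  rw [ofReal_integral_norm_eq_lintegral_enorm this]

/-- `HasLogSpec w A S l`: the low frequencies of `w` grow at most like the square root of a
logarithm. -/
def H1.HasLogSpec (w : H1 2) (A S l : ℝ) : Prop :=
  ∀ ρ : ℝ, 0 < ρ → ∫ ξ in Metric.ball 0 ρ, ‖w.spec ξ‖ ≤
    A + √(S / (4 * Real.pi) * Real.log (1 + (2 * Real.pi * ρ) ^ 2 / l))

/-- Frequencies below $r$ are charged to the constant $A$ and only those beyond $r$ go through
Cauchy–Schwarz, so $S$ need only bound the tail energy. Taking $r=0$ gives bounds uniform in $w$;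
taking $r$ large makes $S$ small for a single $w$. -/
theorem H1.hasLogSpec_of_tail (w : H1 2) {r l S : ℝ} (hl : 0 < l) (hS : 0 ≤ S)
    (hT : ∫⁻ ξ in (Metric.ball 0 r)ᶜ,
      ENNReal.ofReal ((2 * Real.pi * ‖ξ‖) ^ 2 + l) * ‖w.spec ξ‖ₑ ^ 2 ≤ ENNReal.ofReal S) :
    w.HasLogSpec (∫ ξ in Metric.ball 0 r, ‖w.spec ξ‖) S l := by
  intro ρ hρ
  have hA : 0 ≤ ∫ ξ in Metric.ball 0 r, ‖w.spec ξ‖ := integral_nonneg fun _ => norm_nonneg _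
  refine (ENNReal.ofReal_le_ofReal_iff (by positivity)).1 ?_
  rw [ENNReal.ofReal_add hA (Real.sqrt_nonneg _), w.setIntegral_norm_spec,
    w.setIntegral_norm_spec]
  refine (lintegral_mono_set (t := Metric.ball 0 r ∪ Metric.ball 0 ρ ∩ (Metric.ball 0 r)ᶜ)
    ?_).trans ((lintegral_union_le _ _ _).trans ?_)
  · intro x hx
    by_cases h : x ∈ Metric.ball 0 r
    · exact Or.inl h
    · exact Or.inr ⟨hx, h⟩
  · gcongr
    exact w.lintegral_spec_le hρ hl hS hT

/-- Exponential decay of the distribution function. -/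
theorem H1.volume_lt_le (w : H1 2) {A S l t : ℝ} (hS : 0 < S) (hl : 0 < l)
    (h : w.HasLogSpec A S l) (ht : A + 1 < t) :
    volume {x | t < |w.fn x|} ≤ ENNReal.ofReal
      (‖w.grad‖ ^ 2 / (l * (Real.exp (4 * Real.pi / S * (t - 1 - A) ^ 2) - 1))) := by
  set E := Real.exp (4 * Real.pi / S * (t - 1 - A) ^ 2)
  have hpi := Real.pi_pos
  have hs : 0 < t - 1 - A := by linarith
  have hE : 0 < E - 1 := by
    have : 1 < E := Real.one_lt_exp_iff.2 (by positivity)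
    linarith
  -- This $\rho$ solves $A+\sqrt{\frac{S}{4\pi}\log(1+(2\pi\rho)^2/l)}=t-1$. The low part is then at
  -- most $t-1$, so $|w|>t$ forces the remainder to be at least $1$, and Chebyshev applies.
  set ρ := √(l * (E - 1)) / (2 * Real.pi)
  have hρ : 0 < ρ := by positivity
  have hρ2 : (2 * Real.pi * ρ) ^ 2 = l * (E - 1) := by
    have : 2 * Real.pi * ρ = √(l * (E - 1)) := by simp only [ρ]; field_simp
    rw [this, Real.sq_sqrt (by positivity)]
  have hlow : ∀ x, ‖w.lowPart ρ x‖ ≤ t - 1 := fun x => by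
    refine (w.norm_lowPart_le ρ x).trans ((h ρ hρ).trans_eq ?_)
    rw [hρ2, mul_div_cancel_left₀ _ hl.ne', add_sub_cancel, Real.log_exp]
    have : S / (4 * Real.pi) * (4 * Real.pi / S * (t - 1 - A) ^ 2) = (t - 1 - A) ^ 2 := by
      field_simp
    rw [this, Real.sqrt_sq hs.le]
    ring
  obtain ⟨q, hq, hq2⟩ := w.exists_lowPart_add hρ
  rw [hρ2] at hq2
  refine le_trans ?_ hq2
  calc volume {x | t < |w.fn x|} ≤ volume {x | 1 ≤ ‖q x‖ₑ ^ 2} := by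
        refine measure_mono_ae ?_
        filter_upwards [hq] with x hx (hx' : t < |w.fn x|)
        have h1 : |w.fn x| ≤ ‖w.lowPart ρ x‖ + ‖q x‖ := by
          rw [← Real.norm_eq_abs, ← Complex.norm_real, hx]; exact norm_add_le _ _
        have h2 : 1 ≤ ‖q x‖ := by linarith [hlow x]
        change 1 ≤ ‖q x‖ₑ ^ 2
        refine one_le_pow₀ ?_
        rw [← ofReal_norm]
        exact ENNReal.one_le_ofReal.2 h2
    _ ≤ _ := by
        simpa using mul_meas_ge_le_lintegral₀ (μ := volume)
          ((Lp.aestronglyMeasurable q).enorm.pow_const 2) 1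

/-- Up to a constant the exponent is a quadratic in the level with leading coefficient
$\gamma-\beta<0$, hence eventually below any linear function. Starting at $k_0\ge A+2$ keeps the
denominator away from zero. -/
theorem summable_exp_quadratic {β γ A : ℝ} (hγβ : γ < β) (hβ : 0 < β) (k₀ : ℕ)
    (hk : A + 2 ≤ k₀) :
    Summable fun k : ℕ => Real.exp (γ * ((k₀ + k : ℕ) + 1) ^ 2) /
      (Real.exp (β * ((k₀ + k : ℕ) - 1 - A) ^ 2) - 1) := by
  set a := β - γ
  have ha : 0 < a := sub_pos.2 hγβ
  set b := 2 * γ + 2 * β * (1 + A)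
  set c := γ - β * (1 + A) ^ 2
  -- Completing the square: $d$ is the maximum of $-am^2+bm+c+m$ over real $m$.
  set d := c + (b + 1) ^ 2 / (4 * a)
  have hcE : 0 < 1 - Real.exp (-β) := by
    have : Real.exp (-β) < 1 := Real.exp_lt_one_iff.2 (by linarith)
    linarith
  have hgeo : Summable fun k : ℕ => (1 - Real.exp (-β))⁻¹ * Real.exp d * Real.exp (-1) ^ k :=
    (summable_geometric_of_lt_one (Real.exp_pos _).le (Real.exp_lt_one_iff.2 (by norm_num))).mul_left _
  refine Summable.of_nonneg_of_le (fun k => ?_) (fun k => ?_) hgeo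
  · have : 1 ≤ Real.exp (β * ((k₀ + k : ℕ) - 1 - A) ^ 2) := Real.one_le_exp (by positivity)
    exact div_nonneg (Real.exp_pos _).le (by linarith)
  · set m : ℝ := ((k₀ + k : ℕ) : ℝ)
    have hmk : (k : ℝ) ≤ m := by simp [m]
    have hm1 : 1 ≤ m - 1 - A := by
      have : (k₀ : ℝ) ≤ m := by simp [m]
      linarith
    have h1 : (1 - Real.exp (-β)) * Real.exp (β * (m - 1 - A) ^ 2) ≤
        Real.exp (β * (m - 1 - A) ^ 2) - 1 := by
      have : 1 ≤ Real.exp (-β) * Real.exp (β * (m - 1 - A) ^ 2) := by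
        rw [← Real.exp_add]
        refine Real.one_le_exp ?_
        have : 1 ≤ (m - 1 - A) ^ 2 := one_le_pow₀ hm1
        nlinarith
      linarith
    have h2 : γ * (m + 1) ^ 2 - β * (m - 1 - A) ^ 2 ≤ d + -m := by
      have e : γ * (m + 1) ^ 2 - β * (m - 1 - A) ^ 2 = -a * m ^ 2 + b * m + c := by
        simp only [a, b, c]; ring
      have e2 : d + -m - (-a * m ^ 2 + b * m + c) = (2 * a * m - (b + 1)) ^ 2 / (4 * a) := by
        simp only [d]; field_simp; ring
      have : 0 ≤ (2 * a * m - (b + 1)) ^ 2 / (4 * a) := by positivity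
      linarith
    calc Real.exp (γ * (m + 1) ^ 2) / (Real.exp (β * (m - 1 - A) ^ 2) - 1)
        ≤ Real.exp (γ * (m + 1) ^ 2) / ((1 - Real.exp (-β)) * Real.exp (β * (m - 1 - A) ^ 2)) := by
          gcongr
      _ = (1 - Real.exp (-β))⁻¹ * Real.exp (γ * (m + 1) ^ 2 - β * (m - 1 - A) ^ 2) := by
          rw [Real.exp_sub]; field_simp
      _ ≤ (1 - Real.exp (-β))⁻¹ * Real.exp (d + -m) := by gcongr
      _ ≤ (1 - Real.exp (-β))⁻¹ * (Real.exp d * Real.exp (-1) ^ k) := by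
          rw [Real.exp_add, ← Real.exp_nat_mul]
          gcongr
          linarith
      _ = _ := by ring

theorem exp_sub_one_le_mul_exp (x : ℝ) : Real.exp x - 1 ≤ x * Real.exp x := by
  have h1 := Real.add_one_le_exp (-x)
  have h2 : Real.exp x * Real.exp (-x) = 1 := by rw [← Real.exp_add]; simp
  nlinarith [Real.exp_pos x]

/-- Exponential integrability under a logarithmic bound on the low frequencies. -/
theorem exists_lintegral_exp_le {A S l γ : ℝ} (hS : 0 < S) (hl : 0 < l) (hγ : 0 < γ)
    (hγS : γ * S < 4 * Real.pi) :
    ∃ C : ℝ, 0 ≤ C ∧ ∀ w : H1 2, w.HasLogSpec A S l →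
      ∫⁻ x, ENNReal.ofReal (Real.exp (γ * w.fn x ^ 2) - 1) ≤
        ENNReal.ofReal (C * (‖w.1.fst‖ ^ 2 + ‖w.grad‖ ^ 2)) := by
  have hpi := Real.pi_pos
  set β := 4 * Real.pi / S
  have hβ : 0 < β := by positivity
  have hγβ : γ < β := by rwa [lt_div_iff₀ hS]
  obtain ⟨k₀, hk₀⟩ := exists_nat_ge (A + 2)
  have hsum := summable_exp_quadratic (A := A) hγβ hβ k₀ hk₀
  set a : ℕ → ℝ := fun k => Real.exp (γ * ((k₀ + k : ℕ) + 1) ^ 2) /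
      (Real.exp (β * ((k₀ + k : ℕ) - 1 - A) ^ 2) - 1)
  have ha : ∀ k, 0 ≤ a k := fun k => by
    have : 1 ≤ Real.exp (β * ((k₀ + k : ℕ) - 1 - A) ^ 2) := Real.one_le_exp (by positivity)
    exact div_nonneg (Real.exp_pos _).le (by linarith)
  set C₀ := γ * Real.exp (γ * k₀ ^ 2)
  set C₁ := (∑' k, a k) / l
  have hC₀ : 0 ≤ C₀ := by positivity
  have hC₁ : 0 ≤ C₁ := div_nonneg (tsum_nonneg ha) hl.le
  refine ⟨C₀ + C₁, by positivity, fun w hw => ?_⟩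
  have hfm : AEStronglyMeasurable w.fn volume := Lp.aestronglyMeasurable w.1.fst
  have hpt : ∀ x, ENNReal.ofReal (Real.exp (γ * w.fn x ^ 2) - 1) ≤
      ENNReal.ofReal C₀ * ‖w.fn x‖ₑ ^ 2 + ∑' k : ℕ,
        ENNReal.ofReal (Real.exp (γ * ((k₀ + k : ℕ) + 1) ^ 2)) *
          {x | ((k₀ + k : ℕ) : ℝ) < |w.fn x|}.indicator 1 x := by
    intro x
    rcases le_or_gt |w.fn x| k₀ with hx | hx
    · refine le_trans ?_ le_self_add
      rw [← ofReal_norm, ← ENNReal.ofReal_pow (norm_nonneg _), ← ENNReal.ofReal_mul hC₀]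
      refine ENNReal.ofReal_le_ofReal ((exp_sub_one_le_mul_exp _).trans ?_)
      rw [Real.norm_eq_abs, sq_abs]
      have : w.fn x ^ 2 ≤ (k₀ : ℝ) ^ 2 := by rw [← sq_abs]; gcongr
      calc γ * w.fn x ^ 2 * Real.exp (γ * w.fn x ^ 2) ≤
            γ * w.fn x ^ 2 * Real.exp (γ * k₀ ^ 2) := by gcongr
        _ = _ := by simp only [C₀]; ring
    · refine le_trans ?_ le_add_self
      obtain ⟨k, hk1, hk2⟩ : ∃ k : ℕ, ((k₀ + k : ℕ) : ℝ) < |w.fn x| ∧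
          |w.fn x| ≤ ((k₀ + k : ℕ) : ℝ) + 1 := by
        -- The shells are $(m,m+1]$, so the ceiling minus one is the right index and the strict
        -- lower bound matches the distribution function.
        have hc : k₀ < ⌈|w.fn x|⌉₊ := Nat.lt_ceil.2 hx
        refine ⟨⌈|w.fn x|⌉₊ - 1 - k₀, ?_, ?_⟩
        · have : k₀ + (⌈|w.fn x|⌉₊ - 1 - k₀) < ⌈|w.fn x|⌉₊ := by omega
          exact Nat.lt_ceil.1 this
        · have : ((k₀ + (⌈|w.fn x|⌉₊ - 1 - k₀) : ℕ) : ℝ) + 1 = (⌈|w.fn x|⌉₊ : ℝ) := by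
            have : k₀ + (⌈|w.fn x|⌉₊ - 1 - k₀) + 1 = ⌈|w.fn x|⌉₊ := by omega
            exact_mod_cast this
          rw [this]
          exact Nat.le_ceil _
      refine le_trans ?_ (ENNReal.le_tsum k)
      rw [Set.indicator_of_mem (show x ∈ {x | ((k₀ + k : ℕ) : ℝ) < |w.fn x|} from hk1),
        Pi.one_apply, mul_one]
      refine ENNReal.ofReal_le_ofReal ?_
      have h1 : w.fn x ^ 2 ≤ (((k₀ + k : ℕ) : ℝ) + 1) ^ 2 := by rw [← sq_abs]; gcongr
      have h2 : Real.exp (γ * w.fn x ^ 2) ≤ Real.exp (γ * (((k₀ + k : ℕ) : ℝ) + 1) ^ 2) := by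
        gcongr
      linarith
  have hms : ∀ t : ℝ, NullMeasurableSet {x | t < |w.fn x|} volume := fun t =>
    nullMeasurableSet_lt aemeasurable_const hfm.aemeasurable.abs
  have hterm : ∀ k : ℕ, ∫⁻ x, ENNReal.ofReal (Real.exp (γ * ((k₀ + k : ℕ) + 1) ^ 2)) *
      {x | ((k₀ + k : ℕ) : ℝ) < |w.fn x|}.indicator 1 x ≤
      ENNReal.ofReal (‖w.grad‖ ^ 2 / l) * ENNReal.ofReal (a k) := by
    intro k
    rw [lintegral_const_mul' _ _ ENNReal.ofReal_ne_top, lintegral_indicator_one₀ (hms _)]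
    have hk : A + 1 < ((k₀ + k : ℕ) : ℝ) := by
      have : (k₀ : ℝ) ≤ ((k₀ + k : ℕ) : ℝ) := by simp
      linarith
    refine (mul_le_mul_right (w.volume_lt_le hS hl hw hk) _).trans_eq ?_
    rw [← ENNReal.ofReal_mul (Real.exp_pos _).le, ← ENNReal.ofReal_mul (by positivity)]
    congr 1
    simp only [a, β]
    rw [div_mul_div_comm, mul_div_assoc', mul_comm (Real.exp _)]
  have hmeas : ∀ k : ℕ, AEMeasurable (fun x =>
      ENNReal.ofReal (Real.exp (γ * ((k₀ + k : ℕ) + 1) ^ 2)) *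
        {x | ((k₀ + k : ℕ) : ℝ) < |w.fn x|}.indicator 1 x) volume := fun k =>
    (AEMeasurable.indicator₀ aemeasurable_const (hms _)).const_mul _
  calc ∫⁻ x, ENNReal.ofReal (Real.exp (γ * w.fn x ^ 2) - 1)
      ≤ ∫⁻ x, (ENNReal.ofReal C₀ * ‖w.fn x‖ₑ ^ 2 + ∑' k : ℕ,
        ENNReal.ofReal (Real.exp (γ * ((k₀ + k : ℕ) + 1) ^ 2)) *
          {x | ((k₀ + k : ℕ) : ℝ) < |w.fn x|}.indicator 1 x) := lintegral_mono hpt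
    _ = ENNReal.ofReal C₀ * ENNReal.ofReal (‖w.1.fst‖ ^ 2) + ∑' k : ℕ,
        ∫⁻ x, ENNReal.ofReal (Real.exp (γ * ((k₀ + k : ℕ) + 1) ^ 2)) *
          {x | ((k₀ + k : ℕ) : ℝ) < |w.fn x|}.indicator 1 x := by
        rw [lintegral_add_left' ((hfm.enorm.pow_const 2).const_mul _),
          lintegral_const_mul' _ _ ENNReal.ofReal_ne_top, lintegral_tsum hmeas]
        congr 2
        exact lintegral_enorm_sq_eq w.1.fst
    _ ≤ ENNReal.ofReal C₀ * ENNReal.ofReal (‖w.1.fst‖ ^ 2) +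
        ENNReal.ofReal (‖w.grad‖ ^ 2 / l) * ENNReal.ofReal (∑' k, a k) := by
        rw [ENNReal.ofReal_tsum_of_nonneg ha hsum, ← ENNReal.tsum_mul_left]
        gcongr with k
        exact hterm k
    _ ≤ _ := by
        rw [← ENNReal.ofReal_mul hC₀, ← ENNReal.ofReal_mul (by positivity),
          ← ENNReal.ofReal_add (by positivity)
            (mul_nonneg (by positivity) (tsum_nonneg ha))]
        refine ENNReal.ofReal_le_ofReal ?_
        have e : ‖w.grad‖ ^ 2 / l * ∑' k, a k = C₁ * ‖w.grad‖ ^ 2 := by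
          simp only [C₁]; ring
        rw [e]
        nlinarith [sq_nonneg ‖w.1.fst‖, sq_nonneg ‖w.grad‖]

theorem H1.lintegral_symbol_spec (w : H1 2) {l : ℝ} (hl : 0 ≤ l) :
    ∫⁻ ξ, ENNReal.ofReal ((2 * Real.pi * ‖ξ‖) ^ 2 + l) * ‖w.spec ξ‖ₑ ^ 2 =
      ENNReal.ofReal (‖w.grad‖ ^ 2 + l * ‖w.1.fst‖ ^ 2) := by
  have hm : AEMeasurable (fun ξ => ‖w.spec ξ‖ₑ ^ 2) volume :=
    (Lp.aestronglyMeasurable w.spec).enorm.pow_const 2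
  rw [ENNReal.ofReal_add (by positivity) (by positivity), ← w.lintegral_spec_grad,
    ENNReal.ofReal_mul hl, ← w.norm_spec, ← lintegral_enorm_sq_eq,
    ← lintegral_const_mul' _ _ ENNReal.ofReal_ne_top, ← lintegral_add_right' _ (hm.const_mul _)]
  refine lintegral_congr fun ξ => ?_
  rw [ENNReal.ofReal_add (by positivity) hl, add_mul]

/-- The subcritical Trudinger–Moser inequality in the plane, with the sharp threshold `4π`. -/
theorem trudinger_moser {c M γ : ℝ} (hγ : 0 < γ) (hc : 0 ≤ c) (hγc : γ * c < 4 * Real.pi) :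
    ∃ C : ℝ, 0 ≤ C ∧ ∀ w : H1 2, ‖w.grad‖ ^ 2 ≤ c → ‖w.1.fst‖ ≤ M →
      ∫⁻ x, ENNReal.ofReal (Real.exp (γ * w.fn x ^ 2) - 1) ≤ ENNReal.ofReal C := by
  -- Half the gap to the threshold. The choice of $l$ below spends it on $l\|w\|_2^2\le d$, giving
  -- $S=c+d$ with $\gamma S<4\pi$.
  set d := (4 * Real.pi / γ - c) / 2
  have hd : 0 < d := by
    have : c < 4 * Real.pi / γ := by rw [lt_div_iff₀ hγ]; linarith
    simp only [d]; linarith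
  set l := d / (M ^ 2 + 1)
  have hl : 0 < l := by positivity
  have hS : 0 < c + d := by linarith
  have hγS : γ * (c + d) < 4 * Real.pi := by
    have : γ * (4 * Real.pi / γ) = 4 * Real.pi := by field_simp
    have : c + d = (c + 4 * Real.pi / γ) / 2 := by simp only [d]; ring
    rw [this]
    linarith
  obtain ⟨C, hC, h⟩ := exists_lintegral_exp_le (A := 0) hS hl hγ hγS
  refine ⟨C * (M ^ 2 + c), by positivity, fun w hwc hwM => ?_⟩
  have hM2 : ‖w.1.fst‖ ^ 2 ≤ M ^ 2 := by gcongr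
  refine (h w ?_).trans (ENNReal.ofReal_le_ofReal (by gcongr))
  have := w.hasLogSpec_of_tail (r := 0) (S := c + d) hl hS.le ?_
  · simpa using this
  · simp only [Metric.ball_zero, Set.compl_empty, Measure.restrict_univ]
    rw [w.lintegral_symbol_spec hl.le]
    refine ENNReal.ofReal_le_ofReal ?_
    have : l * ‖w.1.fst‖ ^ 2 ≤ d := by
      calc l * ‖w.1.fst‖ ^ 2 ≤ l * (M ^ 2 + 1) := by gcongr; linarith
        _ = d := by simp only [l]; field_simp
    linarith

/-- Every `H¹` function of the plane is exponentially square integrable with every exponent. -/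
theorem H1.lintegral_exp_ne_top (w : H1 2) {γ : ℝ} (hγ : 0 < γ) :
    ∫⁻ x, ENNReal.ofReal (Real.exp (γ * w.fn x ^ 2) - 1) ≠ ⊤ := by
  have hpi := Real.pi_pos
  set S := 2 * Real.pi / γ
  have hS : 0 < S := by positivity
  have hγS : γ * S < 4 * Real.pi := by
    have : γ * S = 2 * Real.pi := by simp only [S]; field_simp
    linarith
  -- The spectral energy is a finite measure, so its mass outside large balls falls below
  -- $S=2\pi/\gamma$.
  set ν := (volume : Measure (RSpace 2)).withDensity
    fun ξ => ENNReal.ofReal ((2 * Real.pi * ‖ξ‖) ^ 2 + 1) * ‖w.spec ξ‖ₑ ^ 2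
  have hν : ν Set.univ ≠ ⊤ := by
    rw [withDensity_apply _ MeasurableSet.univ, Measure.restrict_univ,
      w.lintegral_symbol_spec zero_le_one]
    exact ENNReal.ofReal_ne_top
  have hlim : Tendsto (fun n : ℕ => ν (Metric.ball (0 : RSpace 2) n)ᶜ) atTop
      (𝓝 (ν (⋂ n : ℕ, (Metric.ball (0 : RSpace 2) n)ᶜ))) := by
    refine tendsto_measure_iInter_atTop
      (fun n => Metric.isOpen_ball.measurableSet.compl.nullMeasurableSet) ?_
      ⟨0, ne_top_of_le_ne_top hν (measure_mono (Set.subset_univ _))⟩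
    intro m n hmn
    exact Set.compl_subset_compl.2 (Metric.ball_subset_ball (by exact_mod_cast hmn))
  have hempty : ⋂ n : ℕ, (Metric.ball (0 : RSpace 2) n)ᶜ = ∅ := by
    rw [← Set.compl_iUnion, Metric.iUnion_ball_nat, Set.compl_univ]
  rw [hempty, measure_empty] at hlim
  obtain ⟨n, hn⟩ := (hlim.eventually_lt_const (ENNReal.ofReal_pos.2 hS)).exists
  rw [withDensity_apply _ Metric.isOpen_ball.measurableSet.compl] at hn
  have := w.hasLogSpec_of_tail zero_lt_one hS.le hn.le
  obtain ⟨C, -, h⟩ := exists_lintegral_exp_le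
    (A := ∫ ξ in Metric.ball 0 (n : ℝ), ‖w.spec ξ‖) hS zero_lt_one hγ hγS
  exact ne_top_of_le_ne_top ENNReal.ofReal_ne_top (h w this)

end TrudingerMoser

/-! ### Pointwise bounds for nonlinearities of subexponential growth. -/

section Pointwise

/-- Growth conditions on a nonlinearity: it is `o(s²)` at the origin and `O(exp (γ s²))` for every
`γ > α₀`. -/
structure SubExpGrowth (G : ℝ → ℝ) (α₀ : ℝ) : Prop where
  cont : Continuous G
  small : ∀ ε, 0 < ε → ∃ τ, 0 < τ ∧ ∀ s, |s| ≤ τ → |G s| ≤ ε * s ^ 2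
  growth : ∀ γ, α₀ < γ → ∃ C, ∀ s, |G s| ≤ C * Real.exp (γ * s ^ 2)

variable {G : ℝ → ℝ} {α₀ : ℝ}

theorem mul_sq_le_exp_sub_one (γ s : ℝ) : γ * s ^ 2 ≤ Real.exp (γ * s ^ 2) - 1 := by
  linarith [Real.add_one_le_exp (γ * s ^ 2)]

theorem exp_sub_one_nonneg {γ : ℝ} (hγ : 0 ≤ γ) (s : ℝ) : 0 ≤ Real.exp (γ * s ^ 2) - 1 :=
  (by positivity : 0 ≤ γ * s ^ 2).trans (mul_sq_le_exp_sub_one γ s)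

theorem SubExpGrowth.map_zero (hG : SubExpGrowth G α₀) : G 0 = 0 := by
  obtain ⟨τ, hτ, h⟩ := hG.small 1 one_pos
  simpa using h 0 (by simpa using hτ.le)

/-- Subtracting $1$ costs only a constant: near zero $s^2\le\gamma^{-1}(e^{\gamma s^2}-1)$, and for
$|s|>\tau$ the functions $e^{\gamma s^2}$ and $e^{\gamma s^2}-1$ are comparable. -/
theorem SubExpGrowth.exists_abs_le (hG : SubExpGrowth G α₀) {γ : ℝ} (hγ : 0 < γ) (hαγ : α₀ < γ) :
    ∃ C, 0 ≤ C ∧ ∀ s, |G s| ≤ C * (Real.exp (γ * s ^ 2) - 1) := by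
  obtain ⟨τ, hτ, hs⟩ := hG.small 1 one_pos
  obtain ⟨C, hC⟩ := hG.growth γ hαγ
  have hC0 : 0 ≤ C := by simpa using (abs_nonneg _).trans (hC 0)
  refine ⟨γ⁻¹ + C * (1 + (γ * τ ^ 2)⁻¹), by positivity, fun s => ?_⟩
  have hE := exp_sub_one_nonneg hγ.le s
  have hE' := mul_sq_le_exp_sub_one γ s
  rcases le_or_gt |s| τ with h | h
  · have h1 : |G s| ≤ γ⁻¹ * (Real.exp (γ * s ^ 2) - 1) := by
      rw [inv_mul_eq_div, le_div_iff₀ hγ]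
      linarith [mul_le_mul_of_nonneg_right (hs s h) hγ.le]
    have h2 : 0 ≤ C * (1 + (γ * τ ^ 2)⁻¹) * (Real.exp (γ * s ^ 2) - 1) := by positivity
    rw [add_mul]
    linarith
  · have h0 : τ ^ 2 ≤ s ^ 2 := by rw [← sq_abs s]; gcongr
    have h1 : 1 ≤ (γ * τ ^ 2)⁻¹ * (Real.exp (γ * s ^ 2) - 1) := by
      rw [inv_mul_eq_div, one_le_div (by positivity)]
      exact (mul_le_mul_of_nonneg_left h0 hγ.le).trans hE'
    have h2 : Real.exp (γ * s ^ 2) ≤ (1 + (γ * τ ^ 2)⁻¹) * (Real.exp (γ * s ^ 2) - 1) := by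
      linarith
    have h3 : 0 ≤ γ⁻¹ * (Real.exp (γ * s ^ 2) - 1) := by positivity
    have h4 := (hC s).trans (mul_le_mul_of_nonneg_left h2 hC0)
    rw [add_mul]
    linarith

/-- For large $x$ the spare exponent $\kappa$ absorbs the constant $c/\varepsilon$, since $e^{\kappa
x^2}-1\ge\kappa x^2$. -/
theorem mul_exp_le_mul_exp_sub_one {c ε γ κ x : ℝ} (hγ : 0 ≤ γ) (hε : 0 < ε) (hκ : 0 < κ)
    (hx : c / (ε * κ) ≤ x ^ 2) :
    c * Real.exp (γ * x ^ 2) ≤ ε * (Real.exp ((γ + κ) * x ^ 2) - 1) := by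
  have h1 : 1 ≤ Real.exp (γ * x ^ 2) := Real.one_le_exp (by positivity)
  have h2 := Real.add_one_le_exp (κ * x ^ 2)
  have h3 : c ≤ ε * (κ * x ^ 2) := by
    rw [div_le_iff₀ (by positivity)] at hx; linarith
  rw [add_mul, Real.exp_add]
  have h4 : Real.exp (γ * x ^ 2) * (κ * x ^ 2) ≤
      Real.exp (γ * x ^ 2) * Real.exp (κ * x ^ 2) - 1 := by
    have := mul_le_mul_of_nonneg_left h2 (Real.exp_pos (γ * x ^ 2)).le
    linarith
  calc c * Real.exp (γ * x ^ 2) ≤ ε * (κ * x ^ 2) * Real.exp (γ * x ^ 2) := by gcongr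
    _ = ε * (Real.exp (γ * x ^ 2) * (κ * x ^ 2)) := by ring
    _ ≤ _ := by gcongr

/-- The pointwise Brezis–Lieb inequality. -/
theorem SubExpGrowth.exists_abs_sub_le (hG : SubExpGrowth G α₀) (hα : 0 < α₀) {γ ε : ℝ}
    (hγ : α₀ < γ) (hε : 0 < ε) :
    ∃ K C, 0 < K ∧ ∀ a b, |G (a + b) - G a| ≤
      ε * (Real.exp (γ * a ^ 2) - 1) + C * (Real.exp (K * b ^ 2) - 1) := by
  set γ' := (α₀ + γ) / 2
  have hγ'1 : α₀ < γ' := by simp only [γ']; linarith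
  have hγ'2 : γ' < γ := by simp only [γ']; linarith
  have hγ' : 0 < γ' := hα.trans hγ'1
  have hγ0 : 0 < γ := hα.trans hγ
  obtain ⟨C, hC0, hC⟩ := hG.exists_abs_le hγ' hγ'1
  -- If $|b|\le\delta|a|$, then $|a+b|\le(1+\delta)|a|$, and the enlarged exponent must stay below
  -- $\gamma$.
  obtain ⟨δ, hδ, hδ1, hδγ⟩ : ∃ δ, 0 < δ ∧ δ ≤ 1 ∧ γ' * (1 + δ) ^ 2 < γ := by
    have hq : 0 < (γ - γ') / (4 * γ') := div_pos (by linarith) (by linarith)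
    refine ⟨min 1 ((γ - γ') / (4 * γ')), lt_min one_pos hq, min_le_left _ _, ?_⟩
    set δ := min 1 ((γ - γ') / (4 * γ'))
    have h0 : 0 < δ := lt_min one_pos hq
    have h1 : δ ≤ 1 := min_le_left _ _
    have h2 : δ * (4 * γ') ≤ γ - γ' := (le_div_iff₀ (by linarith)).1 (min_le_right _ _)
    have h3 : γ' * δ ^ 2 ≤ γ' * δ := by gcongr; nlinarith
    nlinarith
  set γ'' := γ' * (1 + δ) ^ 2
  have hγ'' : 0 < γ'' := by positivity
  set K := γ' * (1 + δ⁻¹) ^ 2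
  have hK : 0 < K := by positivity
  set κ := γ - γ''
  have hκ : 0 < κ := sub_pos.2 hδγ
  set T := 2 * C / (ε * κ) + 1
  have hT1 : 1 ≤ T := le_add_of_nonneg_left (by positivity)
  -- The $5$ comes from $(a+b)^2+a^2\le 5a^2$ when $|b|\le|a|$.
  obtain ⟨τ, hτ, hs⟩ := hG.small (ε * γ / 5) (by positivity)
  have hcomp : IsCompact (Set.Icc (-(T * (1 + δ))) (T * (1 + δ))) := isCompact_Icc
  -- Tolerance for uniform continuity: for $|a|>\tau/(1+\delta)$ it is at most
  -- $\varepsilon(e^{\gamma a^2}-1)$.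
  have hτ2 : 0 < ε * (γ * (τ / (1 + δ)) ^ 2) := by positivity
  obtain ⟨d, hd, hunif⟩ := Metric.uniformContinuousOn_iff.1
    (hcomp.uniformContinuousOn_of_continuous hG.cont.continuousOn) _ hτ2
  obtain ⟨B, hB⟩ := hcomp.exists_bound_of_continuousOn hG.cont.continuousOn
  have hB0 : 0 ≤ B := (norm_nonneg _).trans (hB 0 ⟨by nlinarith, by nlinarith⟩)
  -- $2C$ pays for $|b|>\delta|a|$, where $b$ dominates both arguments; $2B/(Kd^2)$ pays for bounded
  -- $a$ with $|b|\ge d$. In all remaining cases the $\varepsilon$ term suffices.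
  refine ⟨K, 2 * C + 2 * B / (K * d ^ 2), hK, fun a b => ?_⟩
  have hEa := exp_sub_one_nonneg hγ0.le a
  have hEa' := mul_sq_le_exp_sub_one γ a
  have hEb := exp_sub_one_nonneg hK.le b
  have hEb' := mul_sq_le_exp_sub_one K b
  have hsub : |G (a + b) - G a| ≤ |G (a + b)| + |G a| := abs_sub _ _
  have hP : 0 ≤ 2 * B / (K * d ^ 2) * (Real.exp (K * b ^ 2) - 1) := by positivity
  have hQ : 0 ≤ 2 * C * (Real.exp (K * b ^ 2) - 1) := by positivity
  have hR : 0 ≤ ε * (Real.exp (γ * a ^ 2) - 1) := by positivity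
  rw [add_mul]
  rcases lt_or_ge (δ * |a|) |b| with hab | hab
  · have ha : |a| ≤ δ⁻¹ * |b| := by
      rw [inv_mul_eq_div, le_div_iff₀ hδ]; linarith
    have hab1 : |a + b| ≤ (1 + δ⁻¹) * |b| := (abs_add_le a b).trans (by linarith)
    have ha1 : |a| ≤ (1 + δ⁻¹) * |b| := by linarith [abs_nonneg b]
    have hmono : ∀ x, |x| ≤ (1 + δ⁻¹) * |b| → |G x| ≤ C * (Real.exp (K * b ^ 2) - 1) := by
      intro x hx
      refine (hC x).trans ?_
      have : γ' * x ^ 2 ≤ K * b ^ 2 := by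
        rw [← sq_abs x, ← sq_abs b]
        calc γ' * |x| ^ 2 ≤ γ' * ((1 + δ⁻¹) * |b|) ^ 2 := by gcongr
          _ = _ := by simp only [K]; ring
      gcongr
    linarith [hmono _ hab1, hmono _ ha1]
  · have hab1 : |a + b| ≤ (1 + δ) * |a| := (abs_add_le a b).trans (by linarith)
    have ha1 : |a| ≤ (1 + δ) * |a| := by nlinarith [abs_nonneg a]
    rcases le_or_gt (2 * C / (ε * κ)) (a ^ 2) with hT | hT
    · have hmono : ∀ x, |x| ≤ (1 + δ) * |a| → |G x| ≤ C * Real.exp (γ'' * a ^ 2) := by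
        intro x hx
        refine (hC x).trans ?_
        have h1 : γ' * x ^ 2 ≤ γ'' * a ^ 2 := by
          rw [← sq_abs x, ← sq_abs a]
          calc γ' * |x| ^ 2 ≤ γ' * ((1 + δ) * |a|) ^ 2 := by gcongr
            _ = _ := by simp only [γ'']; ring
        have h2 := Real.exp_le_exp.2 h1
        gcongr
        linarith
      have h := mul_exp_le_mul_exp_sub_one hγ''.le hε hκ hT
      rw [add_sub_cancel] at h
      linarith [hmono _ hab1, hmono _ ha1]
    · have haT : |a| ≤ T := by
        by_contra hcon
        push Not at hcon
        have : a ^ 2 = |a| * |a| := by rw [← sq_abs]; ring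
        have : T ≤ a ^ 2 := by rw [this]; nlinarith
        simp only [T] at this
        linarith
      have hin : ∀ x, |x| ≤ (1 + δ) * |a| → x ∈ Set.Icc (-(T * (1 + δ))) (T * (1 + δ)) := by
        intro x hx
        have : |x| ≤ T * (1 + δ) := hx.trans (by nlinarith)
        exact abs_le.1 this
      rcases le_or_gt |a| (τ / (1 + δ)) with hat | hat
      · have hle : (1 + δ) * |a| ≤ τ := by
          rw [le_div_iff₀ (by positivity)] at hat; linarith
        have hba : |b| ≤ |a| := hab.trans (by nlinarith [abs_nonneg a])
        have h1 := hs _ (hab1.trans hle)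
        have h2 := hs _ (ha1.trans hle)
        have h3 : (a + b) ^ 2 ≤ 4 * a ^ 2 := by
          have : |a + b| ≤ 2 * |a| := (abs_add_le a b).trans (by linarith)
          rw [← sq_abs (a + b), ← sq_abs a]
          calc |a + b| ^ 2 ≤ (2 * |a|) ^ 2 := by gcongr
            _ = _ := by ring
        have h4 : ε * γ / 5 * (a + b) ^ 2 ≤ ε * γ / 5 * (4 * a ^ 2) := by gcongr
        have h5 : ε * (γ * a ^ 2) ≤ ε * (Real.exp (γ * a ^ 2) - 1) := by gcongr
        linarith
      · rcases lt_or_ge |b| d with hbd | hbd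
        · have h := hunif (a + b) (hin _ hab1) a (hin _ ha1) (by simpa [Real.dist_eq] using hbd)
          rw [Real.dist_eq] at h
          have h1 : (τ / (1 + δ)) ^ 2 ≤ a ^ 2 := by rw [← sq_abs a]; gcongr
          have h2 : ε * (γ * (τ / (1 + δ)) ^ 2) ≤ ε * (Real.exp (γ * a ^ 2) - 1) := by
            gcongr
            exact (mul_le_mul_of_nonneg_left h1 hγ0.le).trans hEa'
          linarith
        · have h1 := hB _ (hin _ hab1)
          have h2 := hB _ (hin _ ha1)
          rw [Real.norm_eq_abs] at h1 h2
          have h3 : 2 * B ≤ 2 * B / (K * d ^ 2) * (Real.exp (K * b ^ 2) - 1) := by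
            have hb2 : K * d ^ 2 ≤ Real.exp (K * b ^ 2) - 1 := by
              refine le_trans ?_ hEb'
              rw [← sq_abs b]
              gcongr
            rw [div_mul_eq_mul_div, le_div_iff₀ (by positivity)]
            gcongr
          linarith

end Pointwise

/-! ### Boundedness and a.e. convergence along weakly convergent sequences. -/

section WeakConvergence

/-- Uniform boundedness for the $u_n$ seen in the bidual, where the embedding is isometric. -/
theorem WeaklyConverges.exists_norm_le {X : Type*} [NormedAddCommGroup X] [NormedSpace ℝ X]
    {u : ℕ → X} {u₀ : X} (h : WeaklyConverges u u₀) : ∃ M, ∀ n, ‖u n‖ ≤ M := by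
  obtain ⟨M, hM⟩ := banach_steinhaus
    (g := fun n => NormedSpace.inclusionInDoubleDualLi ℝ (E := X) (u n)) fun ℓ => by
      obtain ⟨C, hC⟩ := (Metric.isBounded_range_of_tendsto _ (h ℓ)).exists_norm_le
      exact ⟨C, fun n => hC _ ⟨n, rfl⟩⟩
  exact ⟨M, fun n => by simpa only [LinearIsometry.norm_map] using hM n⟩

theorem WeaklyConverges.sub_const {X : Type*} [NormedAddCommGroup X] [NormedSpace ℝ X]
    {u : ℕ → X} {u₀ : X} (h : WeaklyConverges u u₀) :
    WeaklyConverges (fun n => u n - u₀) 0 := fun ℓ => by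
  simpa using (h ℓ).sub_const (ℓ u₀)

variable {N : ℕ}

theorem H1.norm_fst_le (w : H1 N) : ‖w.1.fst‖ ≤ ‖w‖ := WithLp.norm_fst_le (p := 2) (x := w.1)

theorem H1.norm_grad_le (w : H1 N) : ‖w.grad‖ ≤ ‖w‖ := WithLp.norm_snd_le (p := 2) (x := w.1)

theorem H1.fn_sub (w₁ w₂ : H1 N) : (w₁ - w₂).fn =ᵐ[volume] fun x => w₁.fn x - w₂.fn x :=
  Lp.coeFn_sub w₁.1.fst w₂.1.fst

theorem H1.aestronglyMeasurable_fn (w : H1 N) : AEStronglyMeasurable w.fn volume :=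
  Lp.aestronglyMeasurable w.1.fst

theorem H1.continuous_lowPart (ρ : ℝ) (w : H1 N) : Continuous (w.lowPart ρ) :=
  VectorFourier.fourierIntegral_continuous Real.continuous_fourierChar
    (L := innerₗ (RSpace N)) (by exact continuous_inner) (w.integrable_indicator_spec ρ)

theorem WeaklyConverges.tendsto_lowPart {v : ℕ → H1 N} (h : WeaklyConverges v 0) (ρ : ℝ)
    (x : RSpace N) : Tendsto (fun n => (v n).lowPart ρ x) atTop (𝓝 0) := by
  obtain ⟨ℓ, hℓ⟩ := H1.exists_lowPart_clm (N := N) ρ x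
  have hre := h (Complex.reCLM ∘L ℓ)
  have him := h (Complex.imCLM ∘L ℓ)
  simp only [ContinuousLinearMap.comp_apply, map_zero, hℓ, Complex.reCLM_apply,
    Complex.imCLM_apply] at hre him
  have h1 := (Complex.continuous_ofReal.tendsto 0).comp hre
  have h2 := (Complex.continuous_ofReal.tendsto 0).comp him
  have h3 := h1.add (h2.mul_const Complex.I)
  simp only [Function.comp_def, Complex.re_add_im, Complex.ofReal_zero, zero_mul, add_zero] at h3
  exact h3

/-- Weakly null sequences in `H¹` converge to zero locally in measure. -/
theorem WeaklyConverges.tendstoInMeasure {v : ℕ → H1 N} (h : WeaklyConverges v 0)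
    {μ : Measure (RSpace N)} [IsFiniteMeasure μ] (hμ : μ ≤ volume) :
    TendstoInMeasure μ (fun n => (v n).fn) atTop 0 := by
  obtain ⟨M, hM⟩ := h.exists_norm_le
  have hM0 : 0 ≤ M := (norm_nonneg _).trans (hM 0)
  rw [tendstoInMeasure_iff_norm]
  intro ε hε
  rw [ENNReal.tendsto_nhds_zero]
  intro δ hδ
  -- The Chebyshev bound for the high part at level $\varepsilon/2$, uniform in $n$ since $\|\nabla
  -- v_n\|_2\le M$.
  have htail : Tendsto (fun ρ : ℝ => ENNReal.ofReal (M ^ 2 / (2 * Real.pi * ρ) ^ 2 * (4 / ε ^ 2)))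
      atTop (𝓝 0) := by
    have h1 : Tendsto (fun ρ : ℝ => (2 * Real.pi * ρ) ^ 2) atTop atTop :=
      (tendsto_pow_atTop two_ne_zero).comp
        (tendsto_id.const_mul_atTop (by positivity))
    have h2 := (h1.const_div_atTop (M ^ 2)).mul_const (4 / ε ^ 2)
    rw [zero_mul] at h2
    simpa using ENNReal.tendsto_ofReal h2
  have hδ2 : 0 < δ / 2 := ENNReal.half_pos hδ.ne'
  obtain ⟨ρ, hρ, hρ0⟩ := ((htail.eventually_le_const hδ2).and (eventually_gt_atTop 0)).exists
  have hlow : TendstoInMeasure μ (fun n => (v n).lowPart ρ) atTop 0 :=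
    tendstoInMeasure_of_tendsto_ae
      (fun n => ((v n).continuous_lowPart ρ).aestronglyMeasurable)
      (Eventually.of_forall fun x => h.tendsto_lowPart ρ x)
  rw [tendstoInMeasure_iff_norm] at hlow
  filter_upwards [(hlow (ε / 2) (by positivity)).eventually_le_const hδ2] with n hn
  obtain ⟨q, hq, hq2⟩ := (v n).exists_lowPart_add hρ0
  have hq' : ∀ᵐ x ∂μ, ((v n).fn x : ℂ) = (v n).lowPart ρ x + q x :=
    (Measure.absolutelyContinuous_of_le hμ).ae_le hq
  have hcheb : volume {x | ε / 2 ≤ ‖q x‖} ≤ δ / 2 := by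
    have hset : {x | ε / 2 ≤ ‖q x‖} ⊆ {x | ENNReal.ofReal ((ε / 2) ^ 2) ≤ ‖q x‖ₑ ^ 2} := by
      intro x (hx : ε / 2 ≤ ‖q x‖)
      change ENNReal.ofReal ((ε / 2) ^ 2) ≤ ‖q x‖ₑ ^ 2
      rw [← ofReal_norm, ← ENNReal.ofReal_pow (norm_nonneg _)]
      exact ENNReal.ofReal_le_ofReal (by gcongr)
    have h1 := meas_ge_le_lintegral_div (μ := volume)
      ((Lp.aestronglyMeasurable q).enorm.pow_const 2) (ε := ENNReal.ofReal ((ε / 2) ^ 2))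
      (by simpa using by positivity) ENNReal.ofReal_ne_top
    refine (measure_mono hset).trans (h1.trans (le_trans ?_ hρ))
    rw [ENNReal.div_le_iff (by simpa using by positivity) ENNReal.ofReal_ne_top,
      ← ENNReal.ofReal_mul (by positivity)]
    refine hq2.trans (ENNReal.ofReal_le_ofReal ?_)
    have e : M ^ 2 / (2 * Real.pi * ρ) ^ 2 * (4 / ε ^ 2) * (ε / 2) ^ 2 =
        M ^ 2 / (2 * Real.pi * ρ) ^ 2 := by field_simp; norm_num
    rw [e]
    have := (v n).norm_grad_le.trans (hM n)
    gcongr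
  calc μ {x | ε ≤ ‖(v n).fn x - (0 : RSpace N → ℝ) x‖}
      ≤ μ ({x | ε / 2 ≤ ‖(v n).lowPart ρ x - (0 : RSpace N → ℂ) x‖} ∪ {x | ε / 2 ≤ ‖q x‖}) := by
        refine measure_mono_ae ?_
        filter_upwards [hq'] with x hx (hx' : ε ≤ ‖(v n).fn x - (0 : RSpace N → ℝ) x‖)
        change ε / 2 ≤ ‖(v n).lowPart ρ x - (0 : RSpace N → ℂ) x‖ ∨ ε / 2 ≤ ‖q x‖
        simp only [Pi.zero_apply, sub_zero] at hx' ⊢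
        have h1 : ‖(v n).fn x‖ ≤ ‖(v n).lowPart ρ x‖ + ‖q x‖ := by
          rw [← Complex.norm_real, hx]; exact norm_add_le _ _
        by_contra! hcon
        linarith [hcon.1, hcon.2]
    _ ≤ δ / 2 + δ / 2 := (measure_union_le _ _).trans
        (add_le_add hn ((hμ _).trans hcheb))
    _ = δ := ENNReal.add_halves δ

/-- A weakly null sequence in `H¹` has a subsequence that converges to zero a.e. -/
theorem WeaklyConverges.exists_subseq_tendsto_ae {v : ℕ → H1 N} (h : WeaklyConverges v 0) :
    ∃ ns : ℕ → ℕ, StrictMono ns ∧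
      ∀ᵐ x, Tendsto (fun i => (v (ns i)).fn x) atTop (𝓝 0) := by
  -- A Gaussian weight gives a finite measure below Lebesgue measure with the same null sets, so
  -- a.e. convergence transfers back.
  let g : RSpace N → ENNReal := fun x => ENNReal.ofReal (Real.exp (-1 * ‖x‖ ^ 2))
  have hgm : Measurable g := by fun_prop
  have hint : Integrable (fun x : RSpace N => Real.exp (-1 * ‖x‖ ^ 2)) := by
    have := GaussianFourier.integrable_cexp_neg_mul_sq_norm_add (V := RSpace N) (b := 1) (by simp) 0 0
    refine this.norm.congr (Eventually.of_forall fun x => ?_)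
    simp [Complex.norm_exp, ← Complex.ofReal_pow]
  let μ := (volume : Measure (RSpace N)).withDensity g
  have : IsFiniteMeasure μ := isFiniteMeasure_withDensity_ofReal hint.2
  have hμ : μ ≤ volume := by
    calc μ ≤ (volume : Measure (RSpace N)).withDensity 1 :=
          withDensity_mono (Eventually.of_forall fun x =>
            ENNReal.ofReal_le_one.2 (Real.exp_le_one_iff.2 (by nlinarith [sq_nonneg ‖x‖])))
      _ = volume := withDensity_one
  obtain ⟨ns, hns, hae⟩ := (h.tendstoInMeasure hμ).exists_seq_tendsto_ae
  refine ⟨ns, hns, ?_⟩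
  exact (withDensity_absolutelyContinuous' hgm.aemeasurable
    (Eventually.of_forall fun x => by simpa [g] using Real.exp_pos _)).ae_le hae

end WeakConvergence

/-! ### The Brezis–Lieb argument and its application to $F(s)$ and $f(s)s$. -/

section Splitting

/-- The excess $(|D_n|-\varepsilon e_n)^+$ is dominated by $|g|$ and tends to zero a.e., so its
integral vanishes in the limit; what remains is at most $\varepsilon B$. -/
theorem tendsto_integral_zero_of_abs_le {α : Type*} [MeasurableSpace α] {μ : Measure α}
    {D e : ℕ → α → ℝ} {B : ℝ} (hD : ∀ n, Integrable (D n) μ) (he : ∀ n, Integrable (e n) μ)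
    (hB : ∀ᶠ n in atTop, ∫ x, e n x ∂μ ≤ B)
    (hdom : ∀ ε, 0 < ε → ∃ g, Integrable g μ ∧ ∀ n, ∀ᵐ x ∂μ, |D n x| ≤ ε * e n x + g x)
    (he0 : ∀ n x, 0 ≤ e n x) (hlim : ∀ᵐ x ∂μ, Tendsto (fun n => D n x) atTop (𝓝 0)) :
    Tendsto (fun n => ∫ x, D n x ∂μ) atTop (𝓝 0) := by
  rw [Metric.tendsto_nhds]
  intro η hη
  set ε := η / (2 * (|B| + 1))
  have hε : 0 < ε := by positivity
  obtain ⟨g, hg, hgD⟩ := hdom ε hε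
  have hWi : ∀ n, Integrable (fun x => max (|D n x| - ε * e n x) 0) μ := fun n =>
    ((hD n).abs.sub ((he n).const_mul ε)).sup (integrable_zero _ _ _)
  have hW : Tendsto (fun n => ∫ x, max (|D n x| - ε * e n x) 0 ∂μ) atTop (𝓝 (∫ _, 0 ∂μ)) := by
    refine tendsto_integral_of_dominated_convergence (fun x => |g x|)
      (fun n => (hWi n).1) hg.abs (fun n => ?_) ?_
    · filter_upwards [hgD n] with x hx
      rw [Real.norm_eq_abs, abs_of_nonneg (le_max_right _ _)]
      exact max_le (by linarith [le_abs_self (g x)]) (abs_nonneg _)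
    · filter_upwards [hlim] with x hx
      have h0 : Tendsto (fun n => |D n x|) atTop (𝓝 0) := by simpa using hx.abs
      refine squeeze_zero (fun n => le_max_right _ _) (fun n => max_le ?_ (abs_nonneg _)) h0
      linarith [mul_nonneg hε.le (he0 n x)]
  rw [integral_zero] at hW
  filter_upwards [hB, hW.eventually_lt_const (half_pos hη)] with n h1 h2
  rw [Real.dist_eq, sub_zero]
  calc |∫ x, D n x ∂μ| ≤ ∫ x, |D n x| ∂μ := abs_integral_le_integral_abs
    _ ≤ ∫ x, (max (|D n x| - ε * e n x) 0 + ε * e n x) ∂μ := by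
        refine integral_mono (hD n).abs ((hWi n).add ((he n).const_mul ε)) fun x => ?_
        have := le_max_left (|D n x| - ε * e n x) 0
        simp only
        linarith
    _ = ∫ x, max (|D n x| - ε * e n x) 0 ∂μ + ε * ∫ x, e n x ∂μ := by
        rw [integral_add (hWi n) ((he n).const_mul ε), integral_const_mul]
    _ < η / 2 + ε * (|B| + 1) := by
        have : ε * ∫ x, e n x ∂μ ≤ ε * (|B| + 1) := by
          gcongr; linarith [le_abs_self B]
        linarith
    _ = η := by simp only [ε]; field_simp; norm_num

theorem H1.integrable_exp (w : H1 2) {γ : ℝ} (hγ : 0 < γ) :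
    Integrable (fun x => Real.exp (γ * w.fn x ^ 2) - 1) := by
  have hm : AEStronglyMeasurable (fun x => Real.exp (γ * w.fn x ^ 2) - 1) volume :=
    (by fun_prop : Continuous fun s : ℝ => Real.exp (γ * s ^ 2) - 1).comp_aestronglyMeasurable
      w.aestronglyMeasurable_fn
  refine ⟨hm, ?_⟩
  rw [hasFiniteIntegral_iff_ofReal (Eventually.of_forall fun x => exp_sub_one_nonneg hγ.le _)]
  exact (w.lintegral_exp_ne_top hγ).lt_top

theorem SubExpGrowth.integrable {G : ℝ → ℝ} {α₀ : ℝ} (hG : SubExpGrowth G α₀) (hα : 0 < α₀)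
    (w : H1 2) : Integrable (fun x => G (w.fn x)) := by
  obtain ⟨C, -, hC⟩ := hG.exists_abs_le (γ := α₀ + 1) (by linarith) (by linarith)
  exact ((w.integrable_exp (γ := α₀ + 1) (by linarith)).const_mul C).mono'
    (hG.cont.comp_aestronglyMeasurable w.aestronglyMeasurable_fn)
    (Eventually.of_forall fun x => hC _)

/-- Brezis–Lieb splitting below the Trudinger–Moser threshold. -/
theorem SubExpGrowth.brezisLiebSplitting {G : ℝ → ℝ} {α₀ : ℝ} (hG : SubExpGrowth G α₀)
    (hα : 0 < α₀) {u : ℕ → H1 2} {u₀ : H1 2} (hweak : WeaklyConverges u u₀)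
    (hgrad : limsup (fun n => ENNReal.ofReal (‖(u n - u₀).grad‖ ^ 2)) atTop
      < ENNReal.ofReal (4 * Real.pi / α₀)) :
    BrezisLiebSplitting G u u₀ := by
  refine ⟨fun n => hG.integrable hα _, hG.integrable hα _, fun n => hG.integrable hα _, ?_⟩
  have hv := hweak.sub_const
  obtain ⟨M, hM⟩ := hv.exists_norm_le
  obtain ⟨c', hc1, hc2⟩ := exists_between hgrad
  have hc'top : c' ≠ ⊤ := (hc2.trans ENNReal.ofReal_lt_top).ne
  set c := c'.toReal
  have hc0 : 0 ≤ c := ENNReal.toReal_nonneg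
  have hc : c < 4 * Real.pi / α₀ := by
    rw [← ENNReal.ofReal_toReal hc'top] at hc2
    exact (ENNReal.ofReal_lt_ofReal_iff_of_nonneg hc0).1 hc2
  have hgc : ∀ᶠ n in atTop, ‖(u n - u₀).grad‖ ^ 2 ≤ c := by
    filter_upwards [eventually_lt_of_limsup_lt hc1] with n hn
    exact (ENNReal.ofReal_le_iff_le_toReal hc'top).1 hn.le
  -- The strict gap leaves room for an exponent above $\alpha_0$, as the growth bounds require, yet
  -- still below the Trudinger–Moser threshold.
  obtain ⟨γ, hγ1, hγ2⟩ : ∃ γ, α₀ < γ ∧ γ * c < 4 * Real.pi := by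
    have hlim : Tendsto (fun γ : ℝ => γ * c) (𝓝[>] α₀) (𝓝 (α₀ * c)) :=
      ((continuous_id.mul continuous_const).tendsto α₀).mono_left nhdsWithin_le_nhds
    have hlt : α₀ * c < 4 * Real.pi := by
      rw [lt_div_iff₀ hα] at hc; linarith
    exact (eventually_mem_nhdsWithin.and (hlim.eventually_lt_const hlt)).exists
  have hγ : 0 < γ := hα.trans hγ1
  obtain ⟨B, hB0, hB⟩ := trudinger_moser (M := M) hγ hc0 hγ2
  have hBn : ∀ᶠ n in atTop, ∫ x, (Real.exp (γ * (u n - u₀).fn x ^ 2) - 1) ≤ B := by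
    filter_upwards [hgc] with n hn
    rw [integral_eq_lintegral_of_nonneg_ae
      (Eventually.of_forall fun x => exp_sub_one_nonneg hγ.le _)
      ((u n - u₀).integrable_exp hγ).1]
    exact ENNReal.toReal_le_of_le_ofReal hB0
      (hB _ hn ((u n - u₀).norm_fst_le.trans (hM n)))
  obtain ⟨C₁, -, hC₁⟩ := hG.exists_abs_le hγ hγ1
  set D : ℕ → RSpace 2 → ℝ := fun n x =>
    G ((u n).fn x) - (G (u₀.fn x) + G ((u n - u₀).fn x))
  have hDi : ∀ n, Integrable (D n) := fun n =>
    (hG.integrable hα _).sub ((hG.integrable hα _).add (hG.integrable hα _))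
  have hDint : ∀ n, ∫ x, D n x = (∫ x, G ((u n).fn x)) -
      ((∫ x, G (u₀.fn x)) + ∫ x, G ((u n - u₀).fn x)) := fun n => by
    have h₀ := hG.integrable hα u₀
    have h₁ := hG.integrable hα (u n - u₀)
    rw [← integral_add h₀ h₁]
    exact integral_sub (hG.integrable hα (u n)) (h₀.add h₁)
  have hsplit : ∀ n, ∀ᵐ x, (u n).fn x = (u n - u₀).fn x + u₀.fn x := fun n => by
    filter_upwards [H1.fn_sub (u n) u₀] with x hx
    rw [hx, sub_add_cancel]
  have hdom : ∀ ε, 0 < ε → ∃ g, Integrable g ∧ ∀ n, ∀ᵐ x, |D n x| ≤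
      ε * (Real.exp (γ * (u n - u₀).fn x ^ 2) - 1) + g x := by
    intro ε hε
    obtain ⟨K, C, hK, hKC⟩ := hG.exists_abs_sub_le hα hγ1 hε
    -- $K$ may be huge, but $u_0$ is fixed and exponentially integrable with every exponent.
    refine ⟨fun x => C * (Real.exp (K * u₀.fn x ^ 2) - 1) +
      C₁ * (Real.exp (γ * u₀.fn x ^ 2) - 1),
      ((u₀.integrable_exp hK).const_mul C).add ((u₀.integrable_exp hγ).const_mul C₁),
      fun n => ?_⟩
    filter_upwards [hsplit n] with x hx
    have h1 := hKC ((u n - u₀).fn x) (u₀.fn x)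
    rw [← hx] at h1
    have h2 := hC₁ (u₀.fn x)
    have h3 : |D n x| ≤ |G ((u n).fn x) - G ((u n - u₀).fn x)| + |G (u₀.fn x)| := by
      have : D n x = (G ((u n).fn x) - G ((u n - u₀).fn x)) - G (u₀.fn x) := by
        simp only [D]; ring
      rw [this]
      exact abs_sub _ _
    linarith
  refine Tendsto.congr hDint (tendsto_of_subseq_tendsto fun ns hns => ?_)
  have hvns : WeaklyConverges (fun i => u (ns i) - u₀) 0 := fun ℓ => (hv ℓ).comp hns
  obtain ⟨ms, hms, hae⟩ := hvns.exists_subseq_tendsto_ae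
  have htend : Tendsto (fun i => ns (ms i)) atTop atTop := hns.comp hms.tendsto_atTop
  refine ⟨ms, tendsto_integral_zero_of_abs_le (fun i => hDi _)
    (fun i => (u (ns (ms i)) - u₀).integrable_exp hγ) (htend.eventually hBn)
    (fun ε hε => ?_) (fun i x => exp_sub_one_nonneg hγ.le _) ?_⟩
  · obtain ⟨g, hg, h⟩ := hdom ε hε
    exact ⟨g, hg, fun i => h _⟩
  · filter_upwards [hae, ae_all_iff.2 fun i => hsplit (ns (ms i))] with x hx hx'
    have h1 : Tendsto (fun i => (u (ns (ms i))).fn x) atTop (𝓝 (u₀.fn x)) := by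
      simpa [hx'] using hx.add_const (u₀.fn x)
    have h2 := ((hG.cont.tendsto _).comp h1).sub
      (((hG.cont.tendsto _).comp hx).const_add (G (u₀.fn x)))
    rw [hG.map_zero, add_zero, sub_self] at h2
    exact h2

/-- A function dominated by `|s|` times the running maximum of `|f|` has the required growth. -/
theorem SubExpGrowth.of_running_bound {f G : ℝ → ℝ} {α₀ : ℝ} (hG : Continuous G)
    (hsmall : ∀ ε, 0 < ε → ∃ τ, 0 < τ ∧ ∀ s, |s| ≤ τ → |f s| ≤ ε * |s|)
    (hgrow : ∀ γ, α₀ < γ → ∃ C, ∀ s, |f s| ≤ C * Real.exp (γ * s ^ 2)) (hα : 0 < α₀)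
    (hfG : ∀ s m, (∀ t, |t| ≤ |s| → |f t| ≤ m) → |G s| ≤ m * |s|) :
    SubExpGrowth G α₀ := by
  refine ⟨hG, fun ε hε => ?_, fun γ hγ => ?_⟩
  · obtain ⟨τ, hτ, h⟩ := hsmall ε hε
    refine ⟨τ, hτ, fun s hs => (hfG s (ε * |s|) fun t ht => ?_).trans_eq ?_⟩
    · exact (h t (ht.trans hs)).trans (by gcongr)
    · rw [mul_assoc, ← sq, sq_abs]
  · set γ' := (α₀ + γ) / 2
    have h1 : α₀ < γ' := by simp only [γ']; linarith
    -- The gap between the exponents absorbs the extra factor $|s|$.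
    set κ := γ - γ'
    have hκ : 0 < κ := by simp only [κ, γ']; linarith
    obtain ⟨C, hC⟩ := hgrow γ' h1
    have hC0 : 0 ≤ C := by simpa using (abs_nonneg _).trans (hC 0)
    refine ⟨C * (1 + κ⁻¹), fun s => ?_⟩
    have h2 := hfG s (C * Real.exp (γ' * s ^ 2)) fun t ht => (hC t).trans (by
      have : t ^ 2 ≤ s ^ 2 := sq_le_sq.2 ht
      have : 0 < γ' := hα.trans h1
      gcongr)
    have h3 : |s| ≤ (1 + κ⁻¹) * Real.exp (κ * s ^ 2) := by
      have e1 : |s| ≤ 1 + s ^ 2 := by nlinarith [sq_abs s, sq_nonneg (|s| - 1)]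
      have e2 := Real.add_one_le_exp (κ * s ^ 2)
      have e3 : 1 + s ^ 2 ≤ (1 + κ⁻¹) * (κ * s ^ 2 + 1) := by
        have : κ⁻¹ * (κ * s ^ 2) = s ^ 2 := by field_simp
        have : 0 ≤ κ⁻¹ + κ * s ^ 2 := by positivity
        nlinarith
      exact e1.trans (e3.trans (by gcongr))
    calc |G s| ≤ C * Real.exp (γ' * s ^ 2) * |s| := h2
      _ ≤ C * Real.exp (γ' * s ^ 2) * ((1 + κ⁻¹) * Real.exp (κ * s ^ 2)) := by gcongr
      _ = C * (1 + κ⁻¹) * Real.exp (γ * s ^ 2) := by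
        have : γ * s ^ 2 = γ' * s ^ 2 + κ * s ^ 2 := by simp only [κ]; ring
        rw [this, Real.exp_add]
        ring

theorem CondF1.continuous {f : ℝ → ℝ} (hf1 : CondF1 f) (hf_neg : ∀ s, s ≤ 0 → f s = 0) : Continuous f := by
  have h1 : ContinuousOn f (Set.Iic 0) :=
    continuousOn_const.congr fun s hs => hf_neg s hs
  have h := h1.union_of_isClosed hf1.cont isClosed_Iic isClosed_Ici
  rwa [Set.Iic_union_Ici, continuousOn_univ] at h

theorem CondF1.exists_abs_le_mul {f : ℝ → ℝ} (hf1 : CondF1 f) (hf_neg : ∀ s, s ≤ 0 → f s = 0) {ε : ℝ}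
    (hε : 0 < ε) : ∃ τ, 0 < τ ∧ ∀ s, |s| ≤ τ → |f s| ≤ ε * |s| := by
  have h := hf1.small.eventually (Metric.ball_mem_nhds 0 one_pos)
  obtain ⟨r, hr, hr'⟩ := mem_nhdsGT_iff_exists_Ioo_subset.1 h
  have hr0 : (0 : ℝ) < r := hr
  -- On this range $|f(s)|<s^3$ for $s>0$, and $s\le\min(1,\varepsilon)$ gives $s^3\le\varepsilon
  -- s$; $r/2$ stays inside the open interval.
  refine ⟨min (r / 2) (min 1 ε), by positivity, fun s hs => ?_⟩
  rcases le_or_gt s 0 with h0 | h0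
  · rw [hf_neg s h0, abs_zero]; positivity
  · rw [abs_of_pos h0] at hs ⊢
    have hs1 : s ≤ r / 2 := hs.trans (min_le_left _ _)
    have hs2 : s ≤ 1 := hs.trans ((min_le_right _ _).trans (min_le_left _ _))
    have hs3 : s ≤ ε := hs.trans ((min_le_right _ _).trans (min_le_right _ _))
    have h1 : f s / s ^ 3 ∈ Metric.ball (0 : ℝ) 1 := hr' ⟨h0, by linarith⟩
    rw [mem_ball_zero_iff, Real.norm_eq_abs, abs_div, abs_of_pos (pow_pos h0 3),
      div_lt_one (pow_pos h0 3)] at h1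
    have h2 : s ^ 3 ≤ ε * s := by
      have : s ^ 2 ≤ ε := by nlinarith
      calc s ^ 3 = s ^ 2 * s := by ring
        _ ≤ ε * s := by gcongr
    linarith

theorem CondF2.exists_abs_le {f : ℝ → ℝ} {α₀ : ℝ} (hf2 : CondF2 f α₀) (hc : Continuous f)
    (hf_neg : ∀ s, s ≤ 0 → f s = 0) {γ : ℝ} (hγ : α₀ < γ) :
    ∃ C, ∀ s, |f s| ≤ C * Real.exp (γ * s ^ 2) := by
  have hγ0 : 0 < γ := hf2.pos.trans hγ
  obtain ⟨R, hR⟩ := eventually_atTop.1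
    ((hf2.above γ hγ).eventually (Metric.ball_mem_nhds 0 one_pos))
  obtain ⟨B, hB⟩ := (isCompact_Icc (a := 0) (b := R)).exists_bound_of_continuousOn
    hc.continuousOn
  refine ⟨max B 1, fun s => ?_⟩
  have hE : 1 ≤ Real.exp (γ * s ^ 2) := Real.one_le_exp (by positivity)
  have hm : 1 ≤ max B 1 := le_max_right _ _
  rcases le_or_gt s 0 with h0 | h0
  · rw [hf_neg s h0, abs_zero]; positivity
  rcases le_or_gt s R with h1 | h1
  · calc |f s| ≤ B := hB s ⟨h0.le, h1⟩
      _ ≤ max B 1 * 1 := by rw [mul_one]; exact le_max_left _ _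
      _ ≤ _ := by gcongr
  · have h2 := hR s h1.le
    rw [Real.dist_eq, sub_zero, abs_div,
      abs_of_pos (Real.exp_pos _), div_lt_one (Real.exp_pos _)] at h2
    nlinarith

/-- Both $F(s)$ and $f(s)s$ are bounded by $|s|\max_{|t|\le|s|}|f(t)|$, so the general splitting
covers them alike. -/
theorem mainTheorem4 (f : ℝ → ℝ) (α₀ : ℝ)
    (hf1 : CondF1 f) (hf2 : CondF2 f α₀) (hf_neg : ∀ s, s ≤ 0 → f s = 0)
    (u : ℕ → H1 2) (u₀ : H1 2) (hweak : WeaklyConverges u u₀)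
    (hgrad : limsup (fun n => ENNReal.ofReal (‖(u n - u₀).grad‖ ^ 2)) atTop
      < ENNReal.ofReal (4 * Real.pi / α₀)) :
    BrezisLiebSplitting (primitiveF f) u u₀ ∧
    (∀ α q : ℝ, α₀ < α → 4 < q → ContDiff ℝ 1 f →
      (∀ ε : ℝ, 0 < ε → ∃ C : ℝ, 0 < C ∧ ∀ s : ℝ,
        |deriv f s| ≤ ε * |s| ^ 2 + C * |s| ^ (q - 2) * (Real.exp (α * |s| ^ 2) - 1)) →
      BrezisLiebSplitting (fun s => f s * s) u u₀) := by
  have hc := hf1.continuous hf_neg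
  have hsmall : ∀ ε, 0 < ε → ∃ τ, 0 < τ ∧ ∀ s, |s| ≤ τ → |f s| ≤ ε * |s| :=
    fun ε hε => hf1.exists_abs_le_mul hf_neg hε
  have hgrow : ∀ γ, α₀ < γ → ∃ C, ∀ s, |f s| ≤ C * Real.exp (γ * s ^ 2) :=
    fun γ hγ => hf2.exists_abs_le hc hf_neg hγ
  refine ⟨?_, fun _ _ _ _ _ _ => ?_⟩
  · refine (SubExpGrowth.of_running_bound (intervalIntegral.continuous_primitive
      (fun a b => hc.intervalIntegrable a b) 0) hsmall hgrow hf2.pos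
      fun s m h => ?_).brezisLiebSplitting hf2.pos hweak hgrad
    have := intervalIntegral.norm_integral_le_of_norm_le_const (a := 0) (b := s) (f := f) (C := m)
      fun t ht => h t ?_
    · simpa using this
    · rcases Set.mem_uIoc.1 ht with ⟨h1, h2⟩ | ⟨h1, h2⟩
      · rw [abs_of_pos h1, abs_of_nonneg (h1.le.trans h2)]; exact h2
      · rw [abs_of_nonpos h2, abs_of_nonpos (h1.le.trans h2)]; linarith
  · refine (SubExpGrowth.of_running_bound (hc.mul continuous_id) hsmall hgrow hf2.pos
      fun s m h => ?_).brezisLiebSplitting hf2.pos hweak hgrad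
    rw [Pi.mul_apply, abs_mul]
    exact mul_le_mul_of_nonneg_right (h s le_rfl) (abs_nonneg _)

end Splitting
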